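/- Let $G$ be a simple graph on the vertex set $\{1,\dots,n\}$ that is chordal, i.e. its vertices can be ordered so that for each vertex $v$ the subgraph induced on $v$ and those of its neighbours that occur before it is complete. Assume that exactly one connected component of $G$ contains an edge (for example, $G$ is connected and $n\ge 2$). Identify $\mathbb{C}^{2n}$ with the space of complex $2\times n$ matrices $$\begin{pmatrix} x_1 & \cdots & x_n\\ y_1 & \cdots & y_n\end{pmatrix},$$ and let $\mathcal{A}_G$ be the determinantal arrangement consisting of the hypersurfaces $\{x_iy_j-x_jy_i=0\}$, one for each edge $\{i,j\}$ of $G$ with $i<j$. Let $U=\mathbb{C}^{2n}\setminus\bigcup_{V\in\mathcal{A}_G}V$. Then, for every $i\ge 2$ and all choices of base points, there is an isomorphism of groups $\pi_i(U)\cong\pi_i(S^3)$. -/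

import Mathlib

open scoped Topology

namespace DetArrangement

/-- A graph on `n` vertices is chordal if its vertices can be ordered (`σ v` is the position of `v`)
so that for each `v`, the subgraph induced on `v` and those of its neighbours that occur before it
is complete. -/
def IsChordal {n : ℕ} (G : SimpleGraph (Fin n)) : Prop :=
  ∃ σ : Equiv.Perm (Fin n), ∀ v : Fin n,
    G.IsClique (insert v {w : Fin n | G.Adj v w ∧ σ w < σ v})

/-- The `2`-minor `Δ_ij = x_i y_j - x_j y_i` of a `2 × n` matrix with rows `x` and `y`. -/
def minor {n : ℕ} (i j : Fin n) (M : Matrix (Fin 2) (Fin n) ℂ) : ℂ :=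
  M 0 i * M 1 j - M 0 j * M 1 i

/-- The determinantal variety `Var(Δ_ij)` in the space `ℂ^{2n}` of `2 × n` matrices. -/
def detVariety {n : ℕ} (i j : Fin n) : Set (Matrix (Fin 2) (Fin n) ℂ) :=
  {M | minor i j M = 0}

/-- The determinantal arrangement of `G`: the varieties `Var(Δ_ij)`, one for each edge of `G`. -/
def arrangement {n : ℕ} (G : SimpleGraph (Fin n)) : Set (Set (Matrix (Fin 2) (Fin n) ℂ)) :=
  {V | ∃ i j : Fin n, i < j ∧ G.Adj i j ∧ V = detVariety i j}

/-- The complement in `ℂ^{2n}` of the union of the determinantal arrangement of `G`. -/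
def complement {n : ℕ} (G : SimpleGraph (Fin n)) : Set (Matrix (Fin 2) (Fin n) ℂ) :=
  (⋃₀ arrangement G)ᶜ

/-- Exactly one connected component of `G` contains an edge, that is, has at least two vertices.
Every connected graph with at least two vertices satisfies this. -/
def HasUniqueNontrivialComponent {n : ℕ} (G : SimpleGraph (Fin n)) : Prop :=
  ∃! c : G.ConnectedComponent, c.supp.Nontrivial

end DetArrangement

/-!
Moving the column of a fixed non-isolated vertex to the first basis vector by an orthogonal frame
splits `U` as `S³ × (0, ∞) × T`, where `T` is the space of columns normalized at that vertex. It
remains to see that all homotopy groups of `T` in degree at least `2` vanish. Adding the vertices in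
a perfect elimination ordering rooted at the chosen vertex builds `T` as a tower in which every
nontrivial step has fibre `ℂ²` minus finitely many distinct lines through the origin, namely those
spanned by the columns of a clique. Such a fibre is a bundle over `ℂ*` with fibre a finitely
punctured plane, and moving punctures along a homotopy can be followed by moving the points that
avoid them, so everything reduces to a fixed finitely punctured plane. That space is aspherical
because it is covered by a contractible space, glued from half-planes along a tree.
-/

namespace DetArrangement

open scoped unitInterval Topology.Homotopy

section GeneralizedLoops

variable {N X Y : Type*} [TopologicalSpace X] [TopologicalSpace Y] {x : X}

/-- The image of a generalized loop under a continuous map. -/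
def mapLoop (φ : C(X, Y)) (f : Ω^ N X x) : Ω^ N Y (φ x) :=
  ⟨φ.comp f.1, fun y hy => congrArg φ (f.2 y hy)⟩

theorem homotopic_mapLoop {f g : Ω^ N X x} (h : GenLoop.Homotopic f g) (φ : C(X, Y)) :
    GenLoop.Homotopic (mapLoop φ f) (mapLoop φ g) :=
  ContinuousMap.HomotopicRel.comp_continuousMap h φ

theorem homotopic_of_continuous {f g : Ω^ N X x} (H : I × (I^N) → X) (hH : Continuous H)
    (h₀ : ∀ y, H (0, y) = f y) (h₁ : ∀ y, H (1, y) = g y)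
    (hb : ∀ t, ∀ y ∈ Cube.boundary N, H (t, y) = x) : GenLoop.Homotopic f g :=
  ⟨⟨⟨⟨H, hH⟩, h₀, h₁⟩, fun t y hy => (hb t y hy).trans (GenLoop.boundary f y hy).symm⟩⟩

/-- The self-map of the cube stretching the middle `1 / (1 + s)` of every coordinate onto the whole
interval; it is the identity for `s = 0`. -/
noncomputable def cubeStretch (s : I) (y : I^N) : I^N := fun i =>
  Set.projIcc 0 1 zero_le_one ((1 + s) * y i - s / 2 : ℝ)

theorem continuous_cubeStretch : Continuous fun p : I × (I^N) => cubeStretch p.1 p.2 :=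
  continuous_pi fun _ => continuous_projIcc.comp (by fun_prop)

theorem cubeStretch_zero (y : I^N) : cubeStretch 0 y = y := by
  funext i
  simp [cubeStretch]

theorem cubeStretch_mem_boundary (s : I) {y : I^N} (hy : y ∈ Cube.boundary N) :
    cubeStretch s y ∈ Cube.boundary N := by
  have := s.2.1
  obtain ⟨i, hi | hi⟩ := hy
  · exact ⟨i, .inl (Set.projIcc_of_le_left _ (by rw [hi, Set.Icc.coe_zero]; linarith))⟩
  · exact ⟨i, .inr (Set.projIcc_of_right_le _ (by rw [hi, Set.Icc.coe_one]; linarith))⟩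

/-- A continuous function on the cube that vanishes on the boundary and is `1` at the points all of
whose coordinates lie in the middle half of the interval. -/
noncomputable def cubePlateau [Fintype N] (y : I^N) : I :=
  ∏ i, Set.projIcc 0 1 zero_le_one (4 * min (y i : ℝ) (1 - y i))

theorem continuous_cubePlateau [Fintype N] : Continuous (cubePlateau (N := N)) :=
  continuous_finsetProd _ fun _ _ => continuous_projIcc.comp (by fun_prop)

theorem cubePlateau_of_mem_boundary [Fintype N] {y : I^N} (hy : y ∈ Cube.boundary N) :
    cubePlateau y = 0 := by
  obtain ⟨i, hi⟩ := hy
  refine Finset.prod_eq_zero (Finset.mem_univ i) (Set.projIcc_of_le_left _ ?_)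
  rcases hi with hi | hi <;> simp [hi]

theorem cubePlateau_eq_one_or [Fintype N] (y : I^N) :
    cubePlateau y = 1 ∨ cubeStretch 1 y ∈ Cube.boundary N := by
  by_cases h : ∀ i, 1 / 4 ≤ (y i : ℝ) ∧ (y i : ℝ) ≤ 3 / 4
  · refine .inl (Finset.prod_eq_one fun i _ => Set.projIcc_of_right_le _ ?_)
    have : 1 / 4 ≤ min (y i : ℝ) (1 - y i) := le_min (h i).1 (by linarith [(h i).2])
    linarith
  · push Not at h
    obtain ⟨i, hi⟩ := h
    rcases lt_or_ge (y i : ℝ) (1 / 4) with hlt | hge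
    · exact .inr ⟨i, .inl (Set.projIcc_of_le_left _ (by rw [Set.Icc.coe_one]; linarith))⟩
    · have := hi hge
      exact .inr ⟨i, .inr (Set.projIcc_of_right_le _ (by rw [Set.Icc.coe_one]; linarith))⟩

theorem homotopic_const_of_free_homotopy [Finite N] [Nonempty N] (f : Ω^ N X x)
    (H : C(I × (I^N), X)) (h₀ : ∀ y, H (0, y) = f y) (h₁ : ∀ y y', H (1, y) = H (1, y'))
    (hb : ∀ t, ∀ y ∈ Cube.boundary N, ∀ y' ∈ Cube.boundary N, H (t, y) = H (t, y')) :
    GenLoop.Homotopic f GenLoop.const := by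
  have := Fintype.ofFinite N
  have hzero : (0 : I^N) ∈ Cube.boundary N := ⟨Classical.arbitrary N, .inl rfl⟩
  have hbase : ∀ y ∈ Cube.boundary N, H (0, y) = x := fun y hy =>
    (h₀ y).trans (GenLoop.boundary f y hy)
  have hplateau := continuous_cubePlateau (N := N)
  -- After stretching, a point is either mapped to the boundary or sees the constant end of `H`.
  have hcollar : ∀ y, H (cubePlateau y, cubeStretch 1 y) = H (cubePlateau y, 0) := by
    intro y
    rcases cubePlateau_eq_one_or y with h | h
    · rw [h]; exact h₁ _ _
    · exact hb _ _ h _ hzero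
  let radial : Ω^ N X x := ⟨⟨fun y => H (cubePlateau y, 0), by fun_prop⟩, fun y hy => by
    change H (cubePlateau y, 0) = x
    rw [cubePlateau_of_mem_boundary hy, hbase 0 hzero]⟩
  have hstretch : GenLoop.Homotopic f radial := by
    have := continuous_cubeStretch (N := N)
    refine homotopic_of_continuous (fun p => H (p.1 * cubePlateau p.2, cubeStretch p.1 p.2))
      (by fun_prop) (fun y => ?_) (fun y => ?_) fun t y hy => ?_
    · simp only [zero_mul, cubeStretch_zero, h₀]
    · simp only [one_mul, hcollar]; rfl
    · simp only [cubePlateau_of_mem_boundary hy, mul_zero]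
      exact hbase _ (cubeStretch_mem_boundary t hy)
  refine hstretch.trans (homotopic_of_continuous (fun p => H (σ p.1 * cubePlateau p.2, 0))
    (by fun_prop) (fun y => ?_) (fun y => ?_) fun t y hy => ?_)
  · simp only [unitInterval.symm_zero, one_mul]; rfl
  · simp only [unitInterval.symm_one, zero_mul, hbase 0 hzero, GenLoop.const_apply]
  · simp only [cubePlateau_of_mem_boundary hy, mul_zero, hbase 0 hzero]

end GeneralizedLoops

/-- Every `N`-dimensional generalized loop in `X`, at any base point, is null-homotopic relative to
the boundary of the cube. For `N = Fin k` this says that `π_ k` is trivial at all base points. -/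
def LoopsContract (N X : Type*) [TopologicalSpace X] : Prop :=
  ∀ (x : X) (f : Ω^ N X x), GenLoop.Homotopic f GenLoop.const

namespace LoopsContract

variable {N X Y : Type*} [TopologicalSpace X] [TopologicalSpace Y]

theorem of_retract (hX : LoopsContract N X) (s : C(Y, X)) (r : C(X, Y))
    (hrs : Function.LeftInverse r s) : LoopsContract N Y := by
  intro y f
  obtain ⟨H⟩ := homotopic_mapLoop (hX _ (mapLoop s f)) r
  exact ⟨H.cast (by ext z; exact hrs (f z)) (by ext; exact hrs y)⟩

theorem of_homeomorph (hX : LoopsContract N X) (e : Y ≃ₜ X) : LoopsContract N Y :=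
  hX.of_retract (e : C(Y, X)) (e.symm : C(X, Y)) e.left_inv

theorem prod (hX : LoopsContract N X) (hY : LoopsContract N Y) : LoopsContract N (X × Y) := by
  rintro ⟨x, y⟩ f
  obtain ⟨H⟩ := hX _ (mapLoop .fst f)
  obtain ⟨K⟩ := hY _ (mapLoop .snd f)
  exact ⟨H.prod K⟩

theorem of_contractible [Finite N] [Nonempty N] [ContractibleSpace X] : LoopsContract N X := by
  intro x f
  obtain ⟨z, ⟨H⟩⟩ := id_nullhomotopic X
  refine homotopic_const_of_free_homotopy f
    (H.toContinuousMap.comp ((ContinuousMap.id I).prodMap f.1)) (fun y => ?_) (fun y y' => ?_)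
    fun t y hy y' hy' => ?_
  · exact H.apply_zero (f y)
  · exact (H.apply_one (f y)).trans (H.apply_one (f y')).symm
  · exact congrArg (fun w => H (t, w))
      ((GenLoop.boundary f y hy).trans (GenLoop.boundary f y' hy').symm)

end LoopsContract

section Covering

variable {N E X : Type*} [TopologicalSpace E] [TopologicalSpace X]

theorem isPreconnected_cube_boundary [Nontrivial N] : IsPreconnected (Cube.boundary N) := by
  classical
  -- Any point lies in a face of some direction `i`, which meets the face `y j = 0` for `j ≠ i`.
  refine isPreconnected_of_forall 0 fun y ⟨i, hi⟩ => ?_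
  obtain ⟨j, hji⟩ := exists_ne i
  let face (k : N) (a : I) : Set (I^N) := Set.range fun z : I^N => Function.update z k a
  have hpre (k : N) (a : I) : IsPreconnected (face k a) :=
    isPreconnected_range (continuous_id.update k continuous_const)
  have hface {k : N} {a : I} (ha : a = 0 ∨ a = 1) : face k a ⊆ Cube.boundary N := by
    rintro - ⟨z, rfl⟩
    exact ⟨k, by simpa using ha⟩
  refine ⟨face i (y i) ∪ face j 0, Set.union_subset (hface hi) (hface (.inl rfl)),
    .inr ⟨0, Function.update_eq_self j (0 : I^N)⟩, .inl ⟨y, Function.update_eq_self i y⟩,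
    IsPreconnected.union (Function.update (0 : I^N) i (y i)) ⟨0, rfl⟩
      ⟨Function.update (0 : I^N) i (y i), ?_⟩ (hpre i _) (hpre j _)⟩
  simp [hji]

theorem exists_lift_loop [Nonempty N] {p : E → X} (hp : IsCoveringMap p)
    (hs : Function.Surjective p) {x : X} (f : Ω^ N X x) : ∃ g : C(I^N, E), ∀ y, p (g y) = f y := by
  obtain ⟨e, he⟩ := hs x
  let F : C(I × (I^N), X) := f.1.comp ⟨fun q => fun i => q.1 * q.2 i, by fun_prop⟩
  have hF : ∀ y, F (0, y) = p (ContinuousMap.const (I^N) e y) := fun y =>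
    (GenLoop.boundary f _ ⟨Classical.arbitrary N, .inl (zero_mul _)⟩).trans he.symm
  refine ⟨(hp.liftHomotopy F _ hF).comp ⟨fun y => (1, y), by fun_prop⟩, fun y => ?_⟩
  refine (congrFun (hp.liftHomotopy_lifts F _ hF) (1, y)).trans (congrArg f ?_)
  exact funext fun i => one_mul (y i)

theorem LoopsContract.of_covering [Finite N] [Nontrivial N] {p : E → X} (hp : IsCoveringMap p)
    (hs : Function.Surjective p) (K : C(I × E, X)) (hK₀ : ∀ e, K (0, e) = p e)
    (hK₁ : IsLocallyConstant fun e => K (1, e)) : LoopsContract N X := by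
  intro x f
  obtain ⟨g, hg⟩ := exists_lift_loop hp hs f
  have hpg : ∀ y ∈ Cube.boundary N, p (g y) = x := fun y hy =>
    (hg y).trans (GenLoop.boundary f y hy)
  refine homotopic_const_of_free_homotopy f (K.comp ((ContinuousMap.id I).prodMap g))
    (fun y => (hK₀ _).trans (hg y)) (fun y y' => ?_) fun t y hy y' hy' => ?_
  · exact (hK₁.comp_continuous g.continuous).apply_eq_of_isPreconnected isPreconnected_univ
      (Set.mem_univ y) (Set.mem_univ y')
  · exact congrArg (fun e => K (t, e)) <| hp.constOn_of_comp isPreconnected_cube_boundary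
      g.continuous.continuousOn (fun z hz z' hz' => (hpg z hz).trans (hpg z' hz').symm) hy hy'

end Covering

/-- Words without two equal consecutive letters: the elements of the free product of copies of
`ℤ / 2`, one for each letter. -/
def ReducedWord (α : Type*) : Type _ := {l : List α // l.IsChain (· ≠ ·)}

namespace ReducedWord

variable {α : Type*}

instance : TopologicalSpace (ReducedWord α) := ⊥

instance : DiscreteTopology (ReducedWord α) := ⟨rfl⟩

instance : Nonempty (ReducedWord α) := ⟨⟨[], List.isChain_nil⟩⟩

variable [DecidableEq α]

/-- Multiplication of a reduced word by a letter, considered as an involution: cancel the letter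
against the head of the word if possible, and prepend it otherwise. -/
def cross (j : α) (v : ReducedWord α) : ReducedWord α :=
  ⟨if v.1.head? = some j then v.1.tail else j :: v.1, by
    split_ifs with h
    · exact v.2.tail
    · exact v.2.cons fun b hb hjb => h (hjb ▸ hb)⟩

theorem cross_of_head?_ne {j : α} {v : ReducedWord α} (h : v.1.head? ≠ some j) :
    (cross j v).1 = j :: v.1 :=
  if_neg h

theorem exists_eq_cons_of_head?_eq {j : α} {v : ReducedWord α} (h : v.1.head? = some j) :
    v.1 = j :: (cross j v).1 ∧ (cross j v).1.head? ≠ some j := by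
  obtain ⟨u, hu⟩ := List.head?_eq_some_iff.1 h
  have hcross : (cross j v).1 = u := by simp [cross, hu]
  rw [hcross]
  refine ⟨hu, fun hj => ?_⟩
  obtain ⟨w, rfl⟩ := List.head?_eq_some_iff.1 hj
  have hv := v.2
  rw [hu, List.isChain_cons_cons] at hv
  exact hv.1 rfl

theorem cross_cross (j : α) (v : ReducedWord α) : cross j (cross j v) = v := by
  by_cases h : v.1.head? = some j
  · obtain ⟨hv, hj⟩ := exists_eq_cons_of_head?_eq h
    exact Subtype.ext ((cross_of_head?_ne hj).trans hv.symm)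
  · refine Subtype.ext ?_
    simp [cross, h]

theorem neg_one_pow_length_cross (j : α) (v : ReducedWord α) :
    (-1 : ℝ) ^ (cross j v).1.length = -(-1) ^ v.1.length := by
  by_cases h : v.1.head? = some j
  · rw [(exists_eq_cons_of_head?_eq h).1, List.length_cons, pow_succ]
    ring
  · rw [cross_of_head?_ne h, List.length_cons, pow_succ]
    ring

end ReducedWord

section TreePath

variable {α : Type*} (q : α → ℝ)

/-- The piecewise linear bump on `[0, 1]` with value `1` at `1 / 2`. -/
noncomputable def tent (s : ℝ) : ℝ := max 0 (1 - |1 - 2 * s|)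

theorem tent_of_nonpos {s : ℝ} (hs : s ≤ 0) : tent s = 0 :=
  max_eq_left (by rw [abs_of_nonneg (by linarith)]; linarith)

theorem tent_of_one_le {s : ℝ} (hs : 1 ≤ s) : tent s = 0 :=
  max_eq_left (by rw [abs_of_nonpos (by linarith)]; linarith)

/-- The real part of `zigzag`: a sum of bumps over unit intervals, the last letter of the word
giving the height over the first interval. -/
noncomputable def zigzagRe : List α → ℝ → ℝ
  | [], _ => 0
  | j :: u, s => zigzagRe u s + tent (s - u.length) * q j

/-- The path in the plane which starts at `ρ i` and crosses the real axis exactly at the half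
integral times, successively at the points `q j` for the letters `j` of a word, read from the last
one to the first one. -/
noncomputable def zigzag (ρ : ℝ) (l : List α) (s : ℝ) : ℂ :=
  zigzagRe q l s + (ρ * Real.cos (Real.pi * s) : ℝ) * Complex.I

@[fun_prop]
theorem continuous_zigzag (ρ : ℝ) (l : List α) : Continuous (zigzag q ρ l) := by
  have : Continuous (zigzagRe q l) := by
    induction l with
    | nil => exact continuous_const
    | cons j u ih =>
      change Continuous fun s => zigzagRe q u s + max 0 (1 - |1 - 2 * (s - u.length)|) * q j
      fun_prop
  unfold zigzag
  fun_prop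

theorem zigzagRe_zero (l : List α) : zigzagRe q l 0 = 0 := by
  induction l with
  | nil => rfl
  | cons j u ih => rw [zigzagRe, ih, tent_of_nonpos (by simp), zero_mul, add_zero]

theorem zigzagRe_of_length_le (l : List α) {s : ℝ} (hs : l.length ≤ s) : zigzagRe q l s = 0 := by
  induction l with
  | nil => rfl
  | cons j u ih =>
    rw [List.length_cons, Nat.cast_succ] at hs
    rw [zigzagRe, ih (by linarith), tent_of_one_le (by linarith), zero_mul, add_zero]

theorem zigzagRe_cons_of_le (j : α) (u : List α) {s : ℝ} (hs : s ≤ u.length) :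
    zigzagRe q (j :: u) s = zigzagRe q u s := by
  rw [zigzagRe, tent_of_nonpos (by linarith), zero_mul, add_zero]

theorem zigzagRe_cons_of_ge (j : α) (u : List α) {s : ℝ} (hs : u.length ≤ s) :
    zigzagRe q (j :: u) s = tent (s - u.length) * q j := by
  rw [zigzagRe, zigzagRe_of_length_le q u hs, zero_add]

theorem zigzagRe_add_half_mem_range (l : List α) {k : ℕ} (hk : k < l.length) :
    zigzagRe q l (k + 1 / 2) ∈ Set.range q := by
  induction l with
  | nil => simp at hk
  | cons j u ih =>
    rcases (Nat.lt_succ_iff.1 hk).lt_or_eq with hlt | rfl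
    · have : (k : ℝ) + 1 ≤ u.length := mod_cast hlt
      rw [zigzagRe_cons_of_le q j u (by linarith)]
      exact ih hlt
    · rw [zigzagRe_cons_of_ge q j u (by linarith)]
      exact ⟨j, by simp [tent]⟩

theorem zigzag_re (ρ : ℝ) (l : List α) (s : ℝ) : (zigzag q ρ l s).re = zigzagRe q l s := by
  simp [zigzag, -Complex.ofReal_mul]

theorem zigzag_im (ρ : ℝ) (l : List α) (s : ℝ) :
    (zigzag q ρ l s).im = ρ * Real.cos (Real.pi * s) := by
  simp [zigzag, -Complex.ofReal_mul]

theorem zigzag_re_mem_range {ρ : ℝ} (hρ : ρ ≠ 0) (l : List α) {s : ℝ} (hs₀ : 0 ≤ s)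
    (hs₁ : s ≤ l.length) (him : (zigzag q ρ l s).im = 0) :
    (zigzag q ρ l s).re ∈ Set.range q := by
  rw [zigzag_im, mul_eq_zero, or_iff_right hρ] at him
  obtain ⟨k, hk⟩ := Real.cos_eq_zero_iff.1 him
  obtain rfl : s = k + 1 / 2 :=
    mul_left_cancel₀ Real.pi_ne_zero (hk.trans (by ring))
  lift k to ℕ using by
    have : (-1 : ℝ) < k := by linarith
    exact Int.lt_iff_add_one_le.1 (by exact_mod_cast this)
  rw [zigzag_re]
  refine zigzagRe_add_half_mem_range q l ?_
  have : (k : ℝ) < l.length := by push_cast at hs₁; linarith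
  exact_mod_cast this

/-- The point at time `t` on the path from the root of the tree of reduced words to the point at
distance `κ / 2` from the vertex `v` in the direction of the neighbour `cross j v` of `v`, drawn in
the plane by `zigzag`. -/
noncomputable def treePos [DecidableEq α] (ρ : ℝ) (j : α) (κ : ℝ) (v : ReducedWord α) (t : ℝ) : ℂ :=
  if v.1.head? = some j then zigzag q ρ v.1 (t * (v.1.length - κ / 2))
  else zigzag q ρ (j :: v.1) (t * (v.1.length + κ / 2))

variable [DecidableEq α]

theorem continuous_treePos (ρ : ℝ) (j : α) (v : ReducedWord α) :
    Continuous fun p : ℝ × ℝ => treePos q ρ j p.1 v p.2 := by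
  unfold treePos
  split_ifs <;> fun_prop

theorem treePos_zero_closeness (ρ : ℝ) (j : α) (v : ReducedWord α) {t : ℝ} (ht : t ≤ 1) :
    treePos q ρ j 0 v t = zigzag q ρ v.1 (t * v.1.length) := by
  unfold treePos
  split_ifs
  · simp
  · rw [zero_div, add_zero, zigzag, zigzagRe_cons_of_le, zigzag]
    exact mul_le_of_le_one_left (by positivity) ht

theorem treePos_cross (ρ : ℝ) (j : α) (v : ReducedWord α) (t : ℝ) :
    treePos q ρ j 1 (v.cross j) t = treePos q ρ j 1 v t := by
  by_cases h : v.1.head? = some j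
  · obtain ⟨hv, hj⟩ := ReducedWord.exists_eq_cons_of_head?_eq h
    rw [treePos, treePos, if_neg hj, if_pos h, ← hv, hv, List.length_cons]
    congr 1
    push_cast
    ring
  · have hv := ReducedWord.cross_of_head?_ne h
    rw [treePos, treePos, if_pos (by simp [hv]), if_neg h, hv, List.length_cons]
    congr 1
    push_cast
    ring

theorem treePos_start (ρ : ℝ) (j : α) (κ : ℝ) (v : ReducedWord α) :
    treePos q ρ j κ v 0 = ρ * Complex.I := by
  unfold treePos
  split_ifs <;> simp [zigzag, zigzagRe_zero]

theorem treePos_end (ρ : ℝ) (j : α) {κ : ℝ} (hκ₀ : 0 ≤ κ) (hκ₁ : κ ≤ 1) (v : ReducedWord α) :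
    treePos q ρ j κ v 1 =
      ⟨κ * q j, ρ * (-1) ^ v.1.length * Real.cos (Real.pi * (κ / 2))⟩ := by
  unfold treePos
  split_ifs with h
  · obtain ⟨u, hu⟩ := List.head?_eq_some_iff.1 h
    have hlen : (v.1.length : ℝ) = u.length + 1 := by rw [hu, List.length_cons, Nat.cast_succ]
    have htent : tent (1 - κ / 2) = κ := by
      rw [tent, abs_of_nonpos (by linarith), max_eq_right (by linarith)]
      ring
    have hcos : Real.cos (Real.pi * (v.1.length - κ / 2)) =
        (-1) ^ v.1.length * Real.cos (Real.pi * (κ / 2)) := by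
      rw [← Real.cos_nat_mul_pi_sub]
      ring_nf
    apply Complex.ext
    · rw [zigzag_re, hlen, hu, zigzagRe_cons_of_ge q j u (by linarith), one_mul,
        show (u.length + 1 - κ / 2 - u.length : ℝ) = 1 - κ / 2 by ring, htent]
    · rw [zigzag_im, one_mul, hcos, mul_assoc]
  · have htent : tent (κ / 2) = κ := by
      rw [tent, abs_of_nonneg (by linarith), max_eq_right (by linarith)]
      ring
    have hcos : Real.cos (Real.pi * (v.1.length + κ / 2)) =
        (-1) ^ v.1.length * Real.cos (Real.pi * (κ / 2)) := by
      rw [← Real.cos_add_nat_mul_pi]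
      ring_nf
    apply Complex.ext
    · rw [zigzag_re, zigzagRe_cons_of_ge q j v.1 (by linarith), one_mul, add_sub_cancel_left, htent]
    · rw [zigzag_im, one_mul, hcos, mul_assoc]

theorem treePos_re_mem_range {ρ : ℝ} (hρ : ρ ≠ 0) (j : α) {κ : ℝ} (hκ₀ : 0 ≤ κ) (hκ₁ : κ ≤ 1)
    (v : ReducedWord α) {t : ℝ} (ht₀ : 0 ≤ t) (ht₁ : t ≤ 1) (him : (treePos q ρ j κ v t).im = 0) :
    (treePos q ρ j κ v t).re ∈ Set.range q := by
  unfold treePos at him ⊢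
  split_ifs at him ⊢ with h
  · obtain ⟨u, hu⟩ := List.head?_eq_some_iff.1 h
    have hlen : (1 : ℝ) ≤ v.1.length := by simp [hu]
    exact zigzag_re_mem_range q hρ _ (mul_nonneg ht₀ (by linarith)) (by nlinarith) him
  · have : (0 : ℝ) ≤ v.1.length := by positivity
    refine zigzag_re_mem_range q hρ _ (mul_nonneg ht₀ (by linarith)) ?_ him
    rw [List.length_cons, Nat.cast_succ]
    nlinarith

end TreePath

theorem homotopic_of_segment_subset {Y V : Type*} [TopologicalSpace Y] [AddCommGroup V] [Module ℝ V]
    [TopologicalSpace V] [IsTopologicalAddGroup V] [ContinuousSMul ℝ V] {s : Set V} (f g : C(Y, s))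
    (h : ∀ y, segment ℝ (f y : V) (g y) ⊆ s) : f.Homotopic g := by
  refine ⟨⟨⟨fun p => ⟨AffineMap.lineMap (f p.2 : V) (g p.2 : V) (p.1 : ℝ),
    h p.2 ?_⟩, ?_⟩, fun y => ?_, fun y => ?_⟩⟩
  · rw [segment_eq_image_lineMap]
    exact Set.mem_image_of_mem _ p.1.2
  · simp only [AffineMap.lineMap_apply_module]
    fun_prop
  · exact Subtype.ext (AffineMap.lineMap_apply_zero _ _)
  · exact Subtype.ext (AffineMap.lineMap_apply_one _ _)

theorem continuousAt_ite_neg {X Z : Type*} [TopologicalSpace X] [TopologicalSpace Z] {c : X → ℝ}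
    {f g : X → Z} {x : X} (hc : ContinuousAt c x) (hf : ContinuousAt f x) (hg : ContinuousAt g x)
    (h : c x = 0 → f x = g x) : ContinuousAt (fun y => if c y < 0 then f y else g y) x := by
  rcases lt_trichotomy (c x) 0 with hlt | heq | hgt
  · refine hf.congr ?_
    filter_upwards [hc.eventually_lt continuousAt_const hlt] with y hy
    rw [if_pos hy]
  · unfold ContinuousAt at hf hg ⊢
    change Filter.Tendsto _ _ (𝓝 (if c x < 0 then f x else g x))
    rw [if_neg heq.not_lt]
    rw [h heq] at hf
    exact hf.if' hg
  · refine hg.congr ?_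
    filter_upwards [continuousAt_const.eventually_lt hc hgt] with y hy
    rw [if_neg hy.not_gt]

section RealPunctures

variable (S : Finset ℝ)

/-- The complement in the complex plane of a finite set of real numbers. -/
def realPunctured : Set ℂ := {z | ∀ a ∈ S, z ≠ (a : ℂ)}

/-- The component of `ℝ \ S` containing `x`, encoded by the set of punctures to its left. -/
noncomputable def gap (x : ℝ) : Finset ℝ := open Classical in S.filter (· < x)

variable {S}

theorem mem_realPunctured_iff {z : ℂ} : z ∈ realPunctured S ↔ (z.im = 0 → z.re ∉ S) := by
  refine ⟨fun hz him hre => hz _ hre (Complex.ext rfl him), ?_⟩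
  rintro hz a ha rfl
  exact hz rfl ha

theorem eventually_gap_eq {x : ℝ} (hx : x ∉ S) : ∀ᶠ y in 𝓝 x, gap S y = gap S x := by
  have h : ∀ᶠ y in 𝓝 x, ∀ a ∈ S, (a < y ↔ a < x) := by
    rw [Filter.eventually_all_finset]
    intro a ha
    rcases lt_or_gt_of_ne (fun h => hx (h ▸ ha) : a ≠ x) with h | h
    · filter_upwards [lt_mem_nhds h] with y hy
      exact iff_of_true hy h
    · filter_upwards [gt_mem_nhds h] with y hy
      exact iff_of_false hy.not_gt h.not_gt
  filter_upwards [h] with y hy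
  exact Finset.filter_congr hy

theorem notMem_of_mem_segment_of_gap_eq {x y a : ℝ} (hx : x ∉ S) (hy : y ∉ S)
    (h : gap S x = gap S y) (ha : a ∈ segment ℝ x y) : a ∉ S := by
  intro haS
  have hlt : a < x ↔ a < y := by simpa [gap, haS] using congrArg (a ∈ ·) h
  have hax : a ≠ x := fun h => hx (h ▸ haS)
  have hay : a ≠ y := fun h => hy (h ▸ haS)
  rw [segment_eq_uIcc, Set.mem_uIcc] at ha
  grind

theorem exists_gapPoint (S : Finset ℝ) :
    ∃ q : Finset ℝ → ℝ, (∀ g, q g ∉ S) ∧ ∀ x ∉ S, gap S (q (gap S x)) = gap S x := by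
  have : Nonempty {x // x ∉ S} := nonempty_subtype.2 (Infinite.exists_notMem_finset S)
  let q := Function.invFun fun x : {x // x ∉ S} => gap S x
  exact ⟨fun g => q g, fun g => (q g).2, fun x hx =>
    Function.invFun_eq (⟨⟨x, hx⟩, rfl⟩ : ∃ y : {x // x ∉ S}, gap S y = gap S x)⟩

/-- A continuous nonnegative function vanishing exactly on `S`. -/
noncomputable def punctureDist (S : Finset ℝ) (x : ℝ) : ℝ := ∏ a ∈ S, |x - a|

@[fun_prop]
theorem continuous_punctureDist : Continuous (punctureDist S) :=
  continuous_finsetProd _ fun a _ => by fun_prop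

theorem punctureDist_nonneg (x : ℝ) : 0 ≤ punctureDist S x :=
  Finset.prod_nonneg fun _ _ => abs_nonneg _

theorem punctureDist_eq_zero {x : ℝ} : punctureDist S x = 0 ↔ x ∈ S := by
  simp [punctureDist, Finset.prod_eq_zero_iff, sub_eq_zero]

/-- A function on the punctured plane with values in `[0, 1]` which is `1` exactly on the real
axis, and vanishes on a neighbourhood of the non-real points above and below the punctures. -/
noncomputable def gapCloseness (S : Finset ℝ) (z : ℂ) : ℝ :=
  max 0 (punctureDist S z.re - |z.im|) / (punctureDist S z.re + |z.im|)

theorem gapCloseness_nonneg (z : ℂ) : 0 ≤ gapCloseness S z :=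
  div_nonneg (le_max_left _ _) (add_nonneg (punctureDist_nonneg _) (abs_nonneg _))

theorem gapCloseness_le_one (z : ℂ) : gapCloseness S z ≤ 1 := by
  have hdist := punctureDist_nonneg (S := S) z.re
  have him := abs_nonneg z.im
  exact div_le_one_of_le₀ (max_le (by linarith) (by linarith)) (by linarith)

theorem gapCloseness_lt_one {z : ℂ} (hz : z.im ≠ 0) : gapCloseness S z < 1 := by
  have hdist := punctureDist_nonneg (S := S) z.re
  have him := abs_pos.2 hz
  exact (div_lt_one (by linarith)).2 (max_lt (by linarith) (by linarith))

theorem punctureDist_add_abs_im_pos {z : ℂ} (hz : z ∈ realPunctured S) :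
    0 < punctureDist S z.re + |z.im| := by
  have hdist := punctureDist_nonneg (S := S) z.re
  by_cases h : z.im = 0
  · have := punctureDist_eq_zero.not.2 (mem_realPunctured_iff.1 hz h)
    exact add_pos_of_pos_of_nonneg (hdist.lt_of_ne' this) (abs_nonneg _)
  · exact add_pos_of_nonneg_of_pos hdist (abs_pos.2 h)

theorem gapCloseness_eq_one {z : ℂ} (hz : z ∈ realPunctured S) (h : z.im = 0) :
    gapCloseness S z = 1 := by
  have := punctureDist_add_abs_im_pos hz
  simp only [h, abs_zero, add_zero] at this
  simp [gapCloseness, h, this.le, this.ne']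

@[fun_prop]
theorem continuous_gapCloseness : Continuous fun z : realPunctured S => gapCloseness S z :=
  Continuous.div (by fun_prop) (by fun_prop) fun z => (punctureDist_add_abs_im_pos z.2).ne'

theorem eventually_gapCloseness_eq_zero {z : realPunctured S} (h : (z : ℂ).re ∈ S) :
    ∀ᶠ z' : realPunctured S in 𝓝 z, gapCloseness S z' = 0 := by
  have him : (z : ℂ).im ≠ 0 := fun h0 => mem_realPunctured_iff.1 z.2 h0 h
  have : ∀ᶠ z' : realPunctured S in 𝓝 z, punctureDist S (z' : ℂ).re < |(z' : ℂ).im| := by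
    refine ContinuousAt.eventually_lt (by fun_prop) (by fun_prop) ?_
    rw [punctureDist_eq_zero.2 h]
    exact abs_pos.2 him
  filter_upwards [this] with z' hz'
  rw [gapCloseness, max_eq_left (by linarith), zero_div]

theorem eventually_gap_re_eq {z : realPunctured S} (h : (z : ℂ).re ∉ S) :
    ∀ᶠ z' : realPunctured S in 𝓝 z, gap S (z' : ℂ).re = gap S (z : ℂ).re :=
  ((Complex.continuous_re.comp continuous_subtype_val).tendsto z).eventually (eventually_gap_eq h)

theorem continuous_treePos_gap (q : Finset ℝ → ℝ) (ρ : ℝ) (v : ReducedWord (Finset ℝ)) :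
    Continuous fun p : I × realPunctured S =>
      treePos q ρ (gap S (p.2 : ℂ).re) (gapCloseness S p.2) v p.1 := by
  rw [continuous_iff_continuousAt]
  rintro ⟨t, z⟩
  by_cases h : (z : ℂ).re ∈ S
  · have hpath : Continuous fun p : I × realPunctured S =>
        zigzag q ρ v.1 ((p.1 : ℝ) * v.1.length) := by fun_prop
    refine hpath.continuousAt.congr ?_
    filter_upwards [continuousAt_snd.eventually (eventually_gapCloseness_eq_zero h)] with p hp
    rw [hp, treePos_zero_closeness q ρ _ v p.1.2.2]
  · have hpath : Continuous fun p : I × realPunctured S =>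
        treePos q ρ (gap S (z : ℂ).re) (gapCloseness S p.2) v p.1 :=
      (continuous_treePos q ρ (gap S (z : ℂ).re) v).comp
        (f := fun p : I × realPunctured S => (gapCloseness S p.2, (p.1 : ℝ)))
        ((continuous_gapCloseness.comp continuous_snd).prodMk (by fun_prop))
    refine hpath.continuousAt.congr ?_
    filter_upwards [continuousAt_snd.eventually (eventually_gap_re_eq h)] with p hp
    rw [hp]

theorem isOpen_gapChart (g : Finset ℝ) :
    IsOpen {z : realPunctured S | (z : ℂ).im = 0 → gap S (z : ℂ).re = g} := by
  rw [isOpen_iff_mem_nhds]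
  intro z hz
  by_cases h : (z : ℂ).im = 0
  · filter_upwards [eventually_gap_re_eq (mem_realPunctured_iff.1 z.2 h)] with z' hz' _
    exact hz'.trans (hz h)
  · have him : ContinuousAt (fun z' : realPunctured S => (z' : ℂ).im) z := by fun_prop
    filter_upwards [him.eventually_ne h] with z' hz' h'
    exact absurd h' hz'

/-- The covering of the punctured plane with one sheet over the closed upper half-plane and one
over the lower half-plane for each reduced word in the gaps between the punctures. Two sheets are
glued across the gap `g` if their words differ by `ReducedWord.cross g`. In the chart around the
gap `g` the fibre coordinate over both half-planes is the word of the upper sheet adjacent across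
`g`, whence the coordinate changes over the lower half-plane. -/
noncomputable def gapCover (S : Finset ℝ) :
    FiberBundleCore (Finset ℝ) (realPunctured S) (ReducedWord (Finset ℝ)) where
  baseSet g := {z | (z : ℂ).im = 0 → gap S (z : ℂ).re = g}
  isOpen_baseSet := isOpen_gapChart
  indexAt z := gap S (z : ℂ).re
  mem_baseSet_at _ _ := rfl
  coordChange g g' z v :=
    if (z : ℂ).im < 0 then ReducedWord.cross g' (ReducedWord.cross g v) else v
  coordChange_self g z _ v := by simp [ReducedWord.cross_cross]
  continuousOn_coordChange g g' := by
    rintro ⟨z, v⟩ ⟨⟨hg, hg'⟩, -⟩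
    refine (continuousAt_ite_neg (by fun_prop) ?_ continuousAt_snd fun h => ?_).continuousWithinAt
    · exact (continuous_of_discreteTopology (f := fun v : ReducedWord (Finset ℝ) =>
        ReducedWord.cross g' (ReducedWord.cross g v))).continuousAt.comp continuousAt_snd
    · rw [(hg h).symm.trans (hg' h), ReducedWord.cross_cross]
  coordChange_comp g g' g'' z _ v := by
    split_ifs
    · simp only [ReducedWord.cross_cross]
    · rfl

/-- The coordinate of a point of the covering in the chart around the gap containing its real
part. -/
def chartWord (e : (gapCover S).TotalSpace) : ReducedWord (Finset ℝ) := e.2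

/-- The word indexing the sheet of a point of the covering. -/
noncomputable def sheetWord (e : (gapCover S).TotalSpace) : ReducedWord (Finset ℝ) :=
  if (e.proj : ℂ).im < 0 then (chartWord e).cross (gap S (e.proj : ℂ).re) else chartWord e

/-- The sign of the half-plane of a complex number, real numbers counting as positive. -/
noncomputable def halfSign (z : ℂ) : ℝ := if z.im < 0 then -1 else 1

/-- The sign of the half-plane containing the root of the tree of sheets when a point of the
covering is drawn in its own half-plane. -/
noncomputable def rootSign (e : (gapCover S).TotalSpace) : ℝ :=
  halfSign e.proj * (-1) ^ (sheetWord e).1.length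

theorem rootSign_ne_zero (e : (gapCover S).TotalSpace) : rootSign e ≠ 0 := by
  unfold rootSign halfSign
  split_ifs <;> simp

theorem exists_eventually_sheetWord_eq (e₀ : (gapCover S).TotalSpace) :
    ∃ v : ReducedWord (Finset ℝ), ∀ᶠ e in 𝓝 e₀,
      sheetWord e = if (e.proj : ℂ).im < 0 then v.cross (gap S (e₀.proj : ℂ).re) else v := by
  let chart := (gapCover S).localTriv (gap S (e₀.proj : ℂ).re)
  have hmem : e₀ ∈ chart.source := ((gapCover S).mem_localTriv_source _ _).2 fun _ => rfl
  have hchart : ContinuousAt chart e₀ :=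
    chart.continuousOn.continuousAt (chart.open_source.mem_nhds hmem)
  refine ⟨(chart e₀).2, ?_⟩
  filter_upwards [(continuousAt_snd.comp hchart).eventually
    ((isOpen_discrete {(chart e₀).2}).mem_nhds rfl)] with e he
  have hcoord : (chart e).2 = if (e.proj : ℂ).im < 0 then
      ((chartWord e).cross (gap S (e.proj : ℂ).re)).cross (gap S (e₀.proj : ℂ).re)
    else chartWord e := rfl
  rw [← show (chart e).2 = (chart e₀).2 from he, hcoord, sheetWord]
  split_ifs
  · rw [ReducedWord.cross_cross]
  · rfl

theorem rootSign_eq_of_sheetWord_eq {e : (gapCover S).TotalSpace} {v : ReducedWord (Finset ℝ)}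
    {g : Finset ℝ} (h : sheetWord e = if (e.proj : ℂ).im < 0 then v.cross g else v) :
    rootSign e = (-1) ^ v.1.length := by
  rw [rootSign, halfSign, h]
  split_ifs
  · rw [ReducedWord.neg_one_pow_length_cross, neg_mul_neg, one_mul]
  · rw [one_mul]

theorem isLocallyConstant_rootSign : IsLocallyConstant (rootSign (S := S)) := by
  rw [IsLocallyConstant.iff_eventually_eq]
  intro e₀
  obtain ⟨v, hv⟩ := exists_eventually_sheetWord_eq e₀
  filter_upwards [hv] with e he
  rw [rootSign_eq_of_sheetWord_eq he, rootSign_eq_of_sheetWord_eq hv.self_of_nhds]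

/-- The contraction of the tree of sheets onto its root, drawn in the plane with gap `g` crossed at
`q g`. -/
noncomputable def coverPos (q : Finset ℝ → ℝ) (p : I × (gapCover S).TotalSpace) : ℂ :=
  treePos q (rootSign p.2) (gap S (p.2.proj : ℂ).re) (gapCloseness S p.2.proj) (sheetWord p.2) p.1

theorem continuous_coverPos (q : Finset ℝ → ℝ) : Continuous (coverPos (S := S) q) := by
  rw [continuous_iff_continuousAt]
  rintro ⟨t, e₀⟩
  obtain ⟨v, hv⟩ := exists_eventually_sheetWord_eq e₀
  have hproj : Continuous fun p : I × (gapCover S).TotalSpace => p.2.proj :=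
    (gapCover S).continuous_proj.comp continuous_snd
  have him : Continuous fun p : I × (gapCover S).TotalSpace => (p.2.proj : ℂ).im :=
    Complex.continuous_im.comp (continuous_subtype_val.comp hproj)
  let pos (w : ReducedWord (Finset ℝ)) (p : I × (gapCover S).TotalSpace) : ℂ :=
    treePos q ((-1) ^ v.1.length) (gap S (p.2.proj : ℂ).re) (gapCloseness S p.2.proj) w p.1
  have hpos (w) : Continuous (pos w) :=
    (continuous_treePos_gap q _ w).comp (continuous_fst.prodMk hproj)
  let w := v.cross (gap S (e₀.proj : ℂ).re)
  have hlocal : ∀ᶠ p in 𝓝 (t, e₀),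
      (if (p.2.proj : ℂ).im < 0 then pos w p else pos v p) = coverPos q p := by
    filter_upwards [continuousAt_snd.eventually hv] with p hp
    rw [coverPos, rootSign_eq_of_sheetWord_eq hp, hp]
    split_ifs <;> rfl
  refine (continuousAt_ite_neg him.continuousAt (hpos w).continuousAt (hpos v).continuousAt
    fun h => ?_).congr hlocal
  simp only [pos, w, gapCloseness_eq_one e₀.proj.2 h, treePos_cross]

theorem coverPos_mem {q : Finset ℝ → ℝ} (hq : ∀ g, q g ∉ S) (p : I × (gapCover S).TotalSpace) :
    coverPos q p ∈ realPunctured S := by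
  refine mem_realPunctured_iff.2 fun him => ?_
  obtain ⟨g, hg⟩ := treePos_re_mem_range q (rootSign_ne_zero p.2) _ (gapCloseness_nonneg _)
    (gapCloseness_le_one _) _ p.1.2.1 p.1.2.2 him
  exact hg ▸ hq g

theorem coverPos_one (q : Finset ℝ → ℝ) (e : (gapCover S).TotalSpace) :
    coverPos q (1, e) = ⟨gapCloseness S e.proj * q (gap S (e.proj : ℂ).re),
      halfSign e.proj * Real.cos (Real.pi * (gapCloseness S e.proj / 2))⟩ := by
  have hsign : rootSign e * (-1) ^ (sheetWord e).1.length = halfSign e.proj := by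
    rw [rootSign, mul_assoc, ← mul_pow, neg_one_mul, neg_neg, one_pow, mul_one]
  rw [← hsign]
  exact treePos_end q _ _ (gapCloseness_nonneg _) (gapCloseness_le_one _) _

theorem im_mem_segment {p z w : ℂ} (h : p ∈ segment ℝ z w) : p.im ∈ segment ℝ z.im w.im :=
  image_segment ℝ Complex.imLm.toAffineMap z w ▸ Set.mem_image_of_mem Complex.imLm h

theorem re_mem_segment {p z w : ℂ} (h : p ∈ segment ℝ z w) : p.re ∈ segment ℝ z.re w.re :=
  image_segment ℝ Complex.reLm.toAffineMap z w ▸ Set.mem_image_of_mem Complex.reLm h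

theorem segment_subset_realPunctured_of_im_ne_zero {z w : ℂ} (hz : z.im ≠ 0)
    (hw : 0 < halfSign z * w.im) : segment ℝ z w ⊆ realPunctured S := by
  refine fun p hp => mem_realPunctured_iff.2 fun him => ?_
  have h := im_mem_segment hp
  rw [segment_eq_uIcc, Set.mem_uIcc, him] at h
  unfold halfSign at hw
  split_ifs at hw <;> grind

theorem segment_coverPos_one_subset {q : Finset ℝ → ℝ} (hq : ∀ g, q g ∉ S)
    (hgap : ∀ x ∉ S, gap S (q (gap S x)) = gap S x) (e : (gapCover S).TotalSpace) :
    segment ℝ (e.proj : ℂ) (coverPos q (1, e)) ⊆ realPunctured S := by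
  obtain ⟨z, hz⟩ : ∃ z : realPunctured S, z = e.proj := ⟨_, rfl⟩
  rw [coverPos_one, ← hz]
  by_cases h : (z : ℂ).im = 0
  · have hre := mem_realPunctured_iff.1 z.2 h
    refine fun p hp => mem_realPunctured_iff.2 fun _ =>
      notMem_of_mem_segment_of_gap_eq hre (hq _) (hgap _ hre).symm ?_
    simpa [gapCloseness_eq_one z.2 h] using re_mem_segment hp
  · refine segment_subset_realPunctured_of_im_ne_zero h ?_
    have hκ₀ := gapCloseness_nonneg (S := S) z
    have hκ₁ := gapCloseness_lt_one (S := S) h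
    have hcos : 0 < Real.cos (Real.pi * (gapCloseness S z / 2)) :=
      Real.cos_pos_of_mem_Ioo ⟨by nlinarith [Real.pi_pos], by nlinarith [Real.pi_pos]⟩
    have hsign : halfSign z * halfSign z = 1 := by unfold halfSign; split_ifs <;> norm_num
    rwa [← mul_assoc, hsign, one_mul]

theorem loopsContract_realPunctured (N : Type*) [Finite N] [Nontrivial N] (S : Finset ℝ) :
    LoopsContract N (realPunctured S) := by
  obtain ⟨q, hq, hgap⟩ := exists_gapPoint S
  have hpos := continuous_coverPos (S := S) q
  let pos (t : I) : C((gapCover S).TotalSpace, realPunctured S) :=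
    ⟨fun e => ⟨coverPos q (t, e), coverPos_mem hq _⟩,
      (hpos.comp (Continuous.prodMk_right t)).subtype_mk _⟩
  have hproj : ContinuousMap.Homotopic ⟨(gapCover S).proj, (gapCover S).continuous_proj⟩ (pos 1) :=
    homotopic_of_segment_subset _ _ (segment_coverPos_one_subset hq hgap)
  have hcontract : (pos 0).Homotopic (pos 1) :=
    ⟨⟨⟨fun p => pos p.1 p.2, hpos.subtype_mk _⟩,
      fun _ => rfl, fun _ => rfl⟩⟩
  obtain ⟨K⟩ := hproj.trans hcontract.symm
  have hsurj : Function.Surjective (gapCover S).proj := fun z =>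
    ⟨⟨z, Classical.arbitrary (ReducedWord (Finset ℝ))⟩, rfl⟩
  refine .of_covering (FiberBundle.isCoveringMap (F := ReducedWord (Finset ℝ))
    (E := (gapCover S).Fiber)) hsurj K.toContinuousMap K.apply_zero ?_
  have hroot (e) : (K (1, e) : ℂ) = rootSign e * Complex.I := by
    rw [K.apply_one]
    exact treePos_start q _ _ _ _
  refine (IsLocallyConstant.iff_eventually_eq _).2 fun e₀ => ?_
  filter_upwards [(IsLocallyConstant.iff_eventually_eq _).1 isLocallyConstant_rootSign e₀] with e he
  exact Subtype.ext (((hroot e).trans (by rw [he])).trans (hroot e₀).symm)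

end RealPunctures

section Punctures

theorem exists_shear_injOn (S : Finset ℂ) :
    ∃ c : ℝ, Set.InjOn (fun z : ℂ => z.re + c * z.im) S := by
  classical
  obtain ⟨c, hc⟩ := Infinite.exists_notMem_finset
    ((S ×ˢ S).image fun p => -(p.1.re - p.2.re) / (p.1.im - p.2.im))
  refine ⟨c, fun a ha b hb hab => ?_⟩
  dsimp only at hab
  by_cases him : a.im = b.im
  · rw [him] at hab
    exact Complex.ext (by linarith) him
  · refine absurd (Finset.mem_image.2 ⟨(a, b), Finset.mem_product.2 ⟨ha, hb⟩, ?_⟩) hc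
    rw [div_eq_iff (sub_ne_zero.2 him)]
    linarith

theorem exists_homeomorph_im_eq_zero (S : Finset ℂ) : ∃ φ : ℂ ≃ₜ ℂ, ∀ a ∈ S, (φ a).im = 0 := by
  have continuous_mk {f g : ℂ → ℝ} (hf : Continuous f) (hg : Continuous g) :
      Continuous fun z => (⟨f z, g z⟩ : ℂ) :=
    Complex.equivRealProdCLM.symm.continuous.comp (hf.prodMk hg)
  obtain ⟨c, hc⟩ := exists_shear_injOn S
  let shear (z : ℂ) : ℝ := z.re + c * z.im
  let h : Polynomial ℝ := Lagrange.interpolate S shear Complex.im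
  exact ⟨{
    toFun := fun z => ⟨shear z, z.im - h.eval (shear z)⟩
    invFun := fun w => ⟨w.re - c * (w.im + h.eval w.re), w.im + h.eval w.re⟩
    left_inv := fun z => by simp [shear]
    right_inv := fun w => by simp [shear]
    continuous_toFun := continuous_mk (by fun_prop) (by fun_prop)
    continuous_invFun := continuous_mk (by fun_prop) (by fun_prop) },
    fun a ha => sub_eq_zero.2 (Lagrange.eval_interpolate_at_node _ hc ha).symm⟩

theorem loopsContract_compl_points (N : Type*) [Finite N] [Nontrivial N] {ι : Type*} [Finite ι]
    (a : ι → ℂ) : LoopsContract N {z : ℂ | ∀ i, z ≠ a i} := by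
  classical
  have := Fintype.ofFinite ι
  obtain ⟨φ, hφ⟩ := exists_homeomorph_im_eq_zero (Finset.univ.image a)
  have hreal (i) : φ (a i) = (φ (a i)).re := Complex.ext rfl (hφ _ (by simp))
  have hmem (z : ℂ) :
      (∀ i, z ≠ a i) ↔ φ z ∈ realPunctured (Finset.univ.image fun i => (φ (a i)).re) := by
    simp only [realPunctured, Set.mem_ofPred_eq, Finset.forall_mem_image, Finset.mem_univ,
      forall_true_left, ← hreal, ne_eq, φ.injective.eq_iff]
  exact (loopsContract_realPunctured N _).of_homeomorph (φ.subtype hmem)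

end Punctures

section Push

variable {ι V : Type*} [Fintype ι] [NormedAddCommGroup V] [NormedSpace ℝ V]

/-- The perturbation of the identity that moves each of finitely many points `p i` by the vector
`d i` and is supported in the balls of radius `ε` around these points. -/
noncomputable def pointPush (ε : ℝ) (p d : ι → V) (z : V) : V :=
  z + ∑ i, max 0 (1 - ‖z - p i‖ / ε) • d i

theorem continuous_pointPush (ε : ℝ) :
    Continuous fun q : (ι → V) × (ι → V) × V => pointPush ε q.1 q.2.1 q.2.2 := by
  unfold pointPush
  fun_prop

theorem pointPush_zero (ε : ℝ) (p : ι → V) (z : V) : pointPush ε p 0 z = z := by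
  simp [pointPush]

theorem pointPush_center {ε : ℝ} (hε : 0 < ε) {p : ι → V}
    (hp : Pairwise fun i j => ε ≤ ‖p i - p j‖) (d : ι → V) (i : ι) :
    pointPush ε p d (p i) = p i + d i := by
  rw [pointPush, Finset.sum_eq_single i (fun j _ hj => ?_) (by simp)]
  · simp
  · have : 1 ≤ ‖p i - p j‖ / ε := (one_le_div hε).2 (hp hj.symm)
    rw [max_eq_left (by linarith), zero_smul]

theorem norm_pointPush_displacement_sub_le {ε : ℝ} (hε : 0 < ε) (p d : ι → V) (z w : V) :
    ‖(pointPush ε p d z - z) - (pointPush ε p d w - w)‖ ≤ ‖z - w‖ / ε * ∑ i, ‖d i‖ := by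
  rw [pointPush, pointPush, add_sub_cancel_left, add_sub_cancel_left, ← Finset.sum_sub_distrib,
    Finset.mul_sum]
  refine norm_sum_le_of_le _ fun i _ => ?_
  rw [← sub_smul, norm_smul, Real.norm_eq_abs]
  gcongr
  calc |max 0 (1 - ‖z - p i‖ / ε) - max 0 (1 - ‖w - p i‖ / ε)|
      ≤ |(1 - ‖z - p i‖ / ε) - (1 - ‖w - p i‖ / ε)| := by
        simpa using abs_max_sub_max_le_max 0 (1 - ‖z - p i‖ / ε) 0 (1 - ‖w - p i‖ / ε)
    _ = |‖w - p i‖ - ‖z - p i‖| / ε := by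
        rw [sub_sub_sub_cancel_left, ← sub_div, abs_div, abs_of_pos hε]
    _ ≤ ‖z - w‖ / ε := by
        gcongr
        rw [norm_sub_rev z w, ← sub_sub_sub_cancel_right w z (p i)]
        exact abs_norm_sub_norm_le _ _

theorem pointPush_injective {ε : ℝ} (hε : 0 < ε) (p : ι → V) {d : ι → V} (hd : ∑ i, ‖d i‖ < ε) :
    Function.Injective (pointPush ε p d) := by
  intro z w h
  by_contra hzw
  have hpos : 0 < ‖z - w‖ := norm_pos_iff.2 (sub_ne_zero.2 hzw)
  have hle : ‖z - w‖ ≤ ‖z - w‖ / ε * ∑ i, ‖d i‖ := by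
    have := norm_pointPush_displacement_sub_le hε p d z w
    rwa [h, sub_sub_sub_cancel_left, norm_sub_rev w z] at this
  have hlt : ‖z - w‖ / ε * ∑ i, ‖d i‖ < ‖z - w‖ / ε * ε := by gcongr
  rw [div_mul_cancel₀ _ hε.ne'] at hlt
  exact hlt.not_ge hle

theorem pointPush_ne {ε : ℝ} (hε : 0 < ε) {p d : ι → V}
    (hp : Pairwise fun i j => ε ≤ ‖p i - p j‖) (hd : ∑ i, ‖d i‖ < ε) {z : V} {i : ι}
    (hz : z ≠ p i) : pointPush ε p d z ≠ p i + d i := by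
  rw [← pointPush_center hε hp]
  exact (pointPush_injective hε p hd).ne hz

end Push

section Uniformity

variable {ι V : Type*} [NormedAddCommGroup V]

theorem exists_uniform_separation [Finite ι] {Y : Type*} [TopologicalSpace Y] [CompactSpace Y]
    {R : ι → Y → V} (hR : ∀ i, Continuous (R i)) (hd : ∀ y, Function.Injective fun i => R i y) :
    ∃ ε > 0, ∀ y, Pairwise fun i j => ε ≤ ‖R i y - R j y‖ := by
  have hev : ∀ᶠ ε : ℝ in 𝓝[>] 0, ∀ i j, i ≠ j → ∀ y, ε ≤ ‖R i y - R j y‖ := by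
    simp only [Filter.eventually_all]
    intro i j hij
    obtain ⟨δ, hδ, h⟩ := isCompact_univ.exists_forall_le' (f := fun y => ‖R i y - R j y‖)
      ((hR i).sub (hR j)).norm.continuousOn (a := 0)
      fun y _ => norm_pos_iff.2 (sub_ne_zero.2 ((hd y).ne hij))
    filter_upwards [Ioo_mem_nhdsGT hδ] with ε hε y
    exact hε.2.le.trans (h y (Set.mem_univ y))
  obtain ⟨ε, h, hε⟩ := (hev.and self_mem_nhdsWithin).exists
  exact ⟨ε, hε, fun y i j hij => h i j hij y⟩

theorem exists_uniform_step [Fintype ι] {Q : Type*} [TopologicalSpace Q] [CompactSpace Q]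
    {R : ι → I × Q → V} (hR : ∀ i, Continuous (R i)) {ε : ℝ} (hε : 0 < ε) :
    ∃ δ > 0, ∀ t t' : I, dist t t' < δ → ∀ x, ∑ i, ‖R i (t, x) - R i (t', x)‖ < ε := by
  let F : C(I × Q, ι → V) := ⟨fun p i => R i p, continuous_pi hR⟩
  obtain ⟨δ, hδ, h⟩ := Metric.uniformContinuous_iff.1
    (CompactSpace.uniformContinuous_of_continuous F.curry.continuous)
    (ε / (Fintype.card ι + 1)) (by positivity)
  refine ⟨δ, hδ, fun t t' htt x => ?_⟩
  have hlt : ‖F (t, x) - F (t', x)‖ < ε / (Fintype.card ι + 1) := by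
    rw [← dist_eq_norm]
    exact (ContinuousMap.dist_apply_le_dist x).trans_lt (h htt)
  calc ∑ i, ‖R i (t, x) - R i (t', x)‖ ≤ Fintype.card ι • ‖F (t, x) - F (t', x)‖ :=
        Pi.sum_norm_apply_le_norm (F (t, x) - F (t', x))
    _ ≤ (Fintype.card ι + 1) * ‖F (t, x) - F (t', x)‖ := by
        rw [nsmul_eq_mul]
        gcongr
        linarith
    _ < ε := by rwa [lt_div_iff₀' (by positivity)] at hlt

theorem dist_min_min_le (t a b : I) : dist (min t a) (min t b) ≤ dist a b := by
  have hcoe (a b : I) : ((min a b : I) : ℝ) = min (a : ℝ) b := (Subtype.mono_coe _).map_min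
  simpa [Subtype.dist_eq, Real.dist_eq, hcoe] using abs_min_sub_min_le_max (t : ℝ) a t b

end Uniformity

section Lift

variable {ι V : Type*} [NormedAddCommGroup V] [NormedSpace ℝ V]

theorem exists_avoiding_of_steps [Fintype ι] {Y : Type*} [TopologicalSpace Y]
    {P : ℕ → ι → Y → V} {ε : ℝ} (hε : 0 < ε) (hP : ∀ k i, Continuous (P k i))
    (hsep : ∀ k y, Pairwise fun i j => ε ≤ ‖P k i y - P k j y‖)
    (hstep : ∀ k y, ∑ i, ‖P (k + 1) i y - P k i y‖ < ε) {z₀ : Y → V} (hz₀ : Continuous z₀)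
    (hne : ∀ i y, z₀ y ≠ P 0 i y) (k : ℕ) :
    ∃ Z : Y → V, Continuous Z ∧ (∀ i y, Z y ≠ P k i y) ∧
      ∀ y, (∀ l i, P l i y = P 0 i y) → Z y = z₀ y := by
  induction k with
  | zero => exact ⟨z₀, hz₀, hne, fun _ _ => rfl⟩
  | succ k ih =>
    obtain ⟨Z, hZ, hZne, hZrest⟩ := ih
    refine ⟨fun y => pointPush ε (fun i => P k i y) (fun i => P (k + 1) i y - P k i y) (Z y),
      (continuous_pointPush ε).comp ((continuous_pi (hP k)).prodMk
        ((continuous_pi fun i => (hP (k + 1) i).sub (hP k i)).prodMk hZ)),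
      fun i y => ?_, fun y hy => ?_⟩
    · -- A push by less than `ε` is injective, so it keeps `Z y` away from the moved points.
      simpa using pointPush_ne hε (hsep k y) (hstep k y) (hZne i y)
    · have hrest : (fun i => P (k + 1) i y - P k i y) = 0 :=
        funext fun i => by rw [hy, hy k, sub_self, Pi.zero_apply]
      simp only [hrest, pointPush_zero, hZrest y hy]

theorem exists_avoiding_lift [Finite ι] {Q : Type*} [TopologicalSpace Q] [CompactSpace Q]
    {R : ι → I × Q → V} (hR : ∀ i, Continuous (R i))
    (hd : ∀ p, Function.Injective fun i => R i p) {z₀ : Q → V} (hz₀ : Continuous z₀)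
    (hne : ∀ i x, z₀ x ≠ R i (0, x)) :
    ∃ Z : I × Q → V, Continuous Z ∧ (∀ x, Z (0, x) = z₀ x) ∧ (∀ i p, Z p ≠ R i p) ∧
      ∀ x, (∀ i t, R i (t, x) = R i (0, x)) → ∀ t, Z (t, x) = z₀ x := by
  have := Fintype.ofFinite ι
  obtain ⟨ε, hε, hsep⟩ := exists_uniform_separation hR hd
  obtain ⟨δ, hδ, hstep⟩ := exists_uniform_step hR hε
  let τ (k : ℕ) : I := Set.Icc.addNSMul zero_le_one (δ / 2) k
  have hτ₀ : τ 0 = 0 := Subtype.ext (Set.Icc.addNSMul_zero _)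
  obtain ⟨m, hm⟩ := Set.Icc.addNSMul_eq_right (zero_le_one' ℝ) (half_pos hδ)
  have hτstep (k : ℕ) : dist (τ (k + 1)) (τ k) < δ :=
    (Set.Icc.abs_sub_addNSMul_le _ (half_pos hδ).le k
      ⟨Set.Icc.monotone_addNSMul _ (half_pos hδ).le k.le_succ, le_rfl⟩).trans_lt (half_lt_self hδ)
  have hmin₀ (a : I) : min 0 a = 0 := min_eq_left unitInterval.nonneg'
  have hne₀ : ∀ i (p : I × Q), z₀ p.2 ≠ R i (min p.1 (τ 0), p.2) := fun i p => by
    rw [hτ₀, min_eq_right unitInterval.nonneg']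
    exact hne i p.2
  obtain ⟨Z, hZ, hZne, hZrest⟩ := exists_avoiding_of_steps hε
    (P := fun k i (p : I × Q) => R i (min p.1 (τ k), p.2)) (fun k i => (hR i).comp (by fun_prop))
    (fun k p => hsep _) (fun k p => hstep _ _ ((dist_min_min_le _ _ _).trans_lt (hτstep k)) _)
    (hz₀.comp continuous_snd) hne₀ m
  refine ⟨Z, hZ, fun x => hZrest (0, x) fun l i => ?_, fun i p => ?_, fun x hx t =>
    hZrest (t, x) fun l i => ?_⟩
  · simp only [hmin₀]
  · have := hZne i p
    rwa [show τ m = 1 from Subtype.ext (hm m le_rfl), min_eq_left unitInterval.le_one'] at this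
  · exact (hx i _).trans (hx i _).symm

end Lift

theorem LoopsContract.compl_sections {N ι B : Type*} [Finite N] [Nontrivial N] [Finite ι]
    [TopologicalSpace B] (hB : LoopsContract N B) {ρ : ι → B → ℂ} (hρ : ∀ i, Continuous (ρ i))
    (hd : ∀ b, Function.Injective fun i => ρ i b) :
    LoopsContract N {p : B × ℂ | ∀ i, p.2 ≠ ρ i p.1} := by
  rintro ⟨⟨b₀, w₀⟩, hw₀⟩ f
  obtain ⟨H⟩ := hB _ (mapLoop ⟨fun p => p.1.1, by fun_prop⟩ f)
  have hH₀ (y) : H (0, y) = (f y).1.1 := H.apply_zero y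
  have hH₁ (y) : H (1, y) = b₀ := H.apply_one y
  have hHb : ∀ t, ∀ y ∈ Cube.boundary N, H (t, y) = b₀ := fun t y hy =>
    (H.eq_snd t hy).trans rfl
  have hf : Continuous f := f.1.continuous
  have hfb : ∀ y ∈ Cube.boundary N, (f y).1.2 = w₀ := fun y hy => by
    rw [GenLoop.boundary f y hy]
  obtain ⟨Z, hZ, hZ₀, hZne, hZrest⟩ := exists_avoiding_lift
    (R := fun i p => ρ i (H p)) (fun i => (hρ i).comp H.continuous) (fun p => hd _)
    (z₀ := fun y => (f y).1.2) (by fun_prop) (fun i y => by rw [hH₀]; exact (f y).2 i)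
  have hZb : ∀ t, ∀ y ∈ Cube.boundary N, Z (t, y) = w₀ := fun t y hy => by
    rw [hZrest y (fun i t => by rw [hHb t y hy, hHb 0 y hy]) t, hfb y hy]
  let fibre : C({z : ℂ | ∀ i, z ≠ ρ i b₀}, {p : B × ℂ | ∀ i, p.2 ≠ ρ i p.1}) :=
    ⟨fun w => ⟨(b₀, w.1), w.2⟩, by fun_prop⟩
  let g : Ω^ N {z : ℂ | ∀ i, z ≠ ρ i b₀} ⟨w₀, hw₀⟩ :=
    ⟨⟨fun y => ⟨Z (1, y), fun i => hH₁ y ▸ hZne i (1, y)⟩, by fun_prop⟩,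
      fun y hy => Subtype.ext (hZb 1 y hy)⟩
  have hpush : GenLoop.Homotopic f (mapLoop fibre g) := by
    refine homotopic_of_continuous (fun p => ⟨(H p, Z p), fun i => hZne i p⟩) (by fun_prop)
      (fun y => ?_) (fun y => ?_) fun t y hy => ?_
    · exact Subtype.ext (Prod.ext (hH₀ y) (hZ₀ y))
    · exact Subtype.ext (Prod.ext (hH₁ y) rfl)
    · exact Subtype.ext (Prod.ext (hHb t y hy) (hZb t y hy))
  exact hpush.trans (homotopic_mapLoop (loopsContract_compl_points N _ _ g) fibre)

section HomotopyGroups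

variable {N X Y Z : Type*} [TopologicalSpace X] [TopologicalSpace Y] [TopologicalSpace Z]

/-- The map induced on homotopy groups by a continuous map. -/
def homotopyGroupMap (φ : C(X, Z)) (x : X) : HomotopyGroup N X x → HomotopyGroup N Z (φ x) :=
  Quotient.map (mapLoop φ) fun _ _ h => homotopic_mapLoop h φ

theorem homotopyGroupMap_mul [DecidableEq N] [Nonempty N] (φ : C(X, Z)) (x : X)
    (a b : HomotopyGroup N X x) :
    homotopyGroupMap φ x (a * b) = homotopyGroupMap φ x a * homotopyGroupMap φ x b := by
  induction a, b using Quotient.inductionOn₂ with | _ f g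
  let i : N := Classical.arbitrary N
  have htrans : mapLoop φ (GenLoop.transAt i g f) =
      GenLoop.transAt i (mapLoop φ g) (mapLoop φ f) := by
    ext y
    exact apply_ite φ _ _ _
  exact (congrArg (homotopyGroupMap φ x) (HomotopyGroup.mul_spec (i := i))).trans
    ((congrArg (Quotient.mk _) htrans).trans (HomotopyGroup.mul_spec (i := i)).symm)

theorem homotopyGroupMap_fst_injective (hY : LoopsContract N Y) (e : X ≃ₜ Z × Y) (x : X) :
    Function.Injective (homotopyGroupMap (N := N) (.comp .fst (e : C(X, Z × Y))) x) := by
  intro a b hab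
  induction a, b using Quotient.inductionOn₂ with | _ f g
  let fst : C(X, Z) := .comp .fst (e : C(X, Z × Y))
  let snd : C(X, Y) := .comp .snd (e : C(X, Z × Y))
  obtain ⟨H⟩ : GenLoop.Homotopic (mapLoop fst f) (mapLoop fst g) := Quotient.exact hab
  obtain ⟨K⟩ := (hY _ (mapLoop snd f)).trans (hY _ (mapLoop snd g)).symm
  have hprod := ContinuousMap.HomotopicRel.comp_continuousMap ⟨H.prod K⟩ (e.symm : C(Z × Y, X))
  obtain ⟨L⟩ := hprod
  exact Quotient.sound
    ⟨L.cast (by ext y; exact e.left_inv (f y)) (by ext y; exact e.left_inv (g y))⟩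

theorem homotopyGroupMap_fst_surjective (e : X ≃ₜ Z × Y) (x : X) :
    Function.Surjective (homotopyGroupMap (N := N) (.comp .fst (e : C(X, Z × Y))) x) := by
  intro b
  induction b using Quotient.inductionOn with | _ g
  let f : Ω^ N X x :=
    ⟨.comp (e.symm : C(Z × Y, X)) (g.1.prodMk (.const _ (e x).2)), fun y hy =>
      e.symm_apply_eq.2 (Prod.ext (GenLoop.boundary g y hy) rfl)⟩
  refine ⟨⟦f⟧, congrArg (Quotient.mk _) ?_⟩
  ext y
  exact congrArg Prod.fst (e.apply_symm_apply (g y, (e x).2))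

theorem nonempty_homotopyGroup_mulEquiv [DecidableEq N] [Nonempty N] (hY : LoopsContract N Y)
    (e : X ≃ₜ Z × Y) {x : X} {z : Z} (hz : (e x).1 = z) :
    Nonempty (HomotopyGroup N X x ≃* HomotopyGroup N Z z) := by
  subst hz
  let fst : C(X, Z) := .comp .fst (e : C(X, Z × Y))
  exact ⟨.ofBijective (MulHom.mk _ (homotopyGroupMap_mul fst x))
    ⟨homotopyGroupMap_fst_injective hY e x, homotopyGroupMap_fst_surjective e x⟩⟩

end HomotopyGroups

section Plane

open ComplexConjugate

/-- The complex plane `ℂ²` with its Hermitian norm, which contains the columns of a `2 × n`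
matrix. -/
abbrev Plane : Type := EuclideanSpace ℂ (Fin 2)

/-- The first standard basis vector of `ℂ²`. -/
def Plane.e₁ : Plane := !₂[1, 0]

/-- The determinant of the matrix with columns `v` and `w`. -/
def wedge (v w : Plane) : ℂ := v 0 * w 1 - w 0 * v 1

/-- The vector with coordinates `x` in the orthogonal frame of `ℂ²` that starts with `v` and
consists of two vectors of the same length. -/
def frameVec (v x : Plane) : Plane :=
  !₂[x 0 * v 0 - x 1 * conj (v 1), x 0 * v 1 + x 1 * conj (v 0)]

/-- The coordinates of `p` in the orthogonal frame of `frameVec v`. -/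
noncomputable def frameCoord (v p : Plane) : Plane :=
  !₂[(conj (v 0) * p 0 + conj (v 1) * p 1) / (‖v‖ : ℂ) ^ 2, wedge v p / (‖v‖ : ℂ) ^ 2]

theorem Plane.ext {v w : Plane} (h₀ : v 0 = w 0) (h₁ : v 1 = w 1) : v = w := by
  ext i
  fin_cases i <;> assumption

theorem continuous_plane_mk {Y : Type*} [TopologicalSpace Y] {f g : Y → ℂ} (hf : Continuous f)
    (hg : Continuous g) : Continuous fun y => (!₂[f y, g y] : Plane) :=
  (PiLp.continuous_toLp 2 _).comp (continuous_pi (Fin.forall_fin_two.2 ⟨hf, hg⟩))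

theorem continuous_wedge {Y : Type*} [TopologicalSpace Y] {f g : Y → Plane} (hf : Continuous f)
    (hg : Continuous g) : Continuous fun y => wedge (f y) (g y) := by
  unfold wedge
  fun_prop

theorem continuous_frameVec {Y : Type*} [TopologicalSpace Y] {f g : Y → Plane} (hf : Continuous f)
    (hg : Continuous g) : Continuous fun y => frameVec (f y) (g y) :=
  continuous_plane_mk (by fun_prop) (by fun_prop)

theorem continuous_frameCoord {Y : Type*} [TopologicalSpace Y] {f g : Y → Plane}
    (hf : Continuous f) (hf₀ : ∀ y, f y ≠ 0) (hg : Continuous g) :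
    Continuous fun y => frameCoord (f y) (g y) := by
  have hne (y : Y) : (‖f y‖ : ℂ) ^ 2 ≠ 0 := by simpa using hf₀ y
  exact continuous_plane_mk (.div (by fun_prop) (by fun_prop) hne)
    (.div (continuous_wedge hf hg) (by fun_prop) hne)

theorem norm_sq_plane (v : Plane) : (‖v‖ : ℂ) ^ 2 = v 0 * conj (v 0) + v 1 * conj (v 1) := by
  rw [← Complex.ofReal_pow, EuclideanSpace.norm_sq_eq, Fin.sum_univ_two]
  simp [Complex.mul_conj']

theorem wedge_frameVec (v x y : Plane) :
    wedge (frameVec v x) (frameVec v y) = (‖v‖ : ℂ) ^ 2 * wedge x y := by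
  rw [norm_sq_plane]
  simp only [wedge, frameVec, Matrix.cons_val_zero, Matrix.cons_val_one, Matrix.cons_val_fin_one]
  ring

theorem frameVec_frameCoord {v : Plane} (hv : v ≠ 0) (p : Plane) :
    frameVec v (frameCoord v p) = p := by
  have hne : (‖v‖ : ℂ) ≠ 0 := by simpa using hv
  refine Plane.ext ?_ ?_
  · simp only [frameVec, frameCoord, wedge, Matrix.cons_val_zero, Matrix.cons_val_one,
      Matrix.cons_val_fin_one]
    field_simp
    linear_combination -p 0 * norm_sq_plane v
  · simp only [frameVec, frameCoord, wedge, Matrix.cons_val_zero, Matrix.cons_val_one,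
      Matrix.cons_val_fin_one]
    field_simp
    linear_combination -p 1 * norm_sq_plane v

theorem frameCoord_frameVec {v : Plane} (hv : v ≠ 0) (x : Plane) :
    frameCoord v (frameVec v x) = x := by
  have hne : (‖v‖ : ℂ) ≠ 0 := by simpa using hv
  refine Plane.ext ?_ ?_
  · simp only [frameVec, frameCoord, wedge, Matrix.cons_val_zero, Matrix.cons_val_one,
      Matrix.cons_val_fin_one]
    field_simp
    linear_combination -x 0 * norm_sq_plane v
  · simp only [frameVec, frameCoord, wedge, Matrix.cons_val_zero, Matrix.cons_val_one,
      Matrix.cons_val_fin_one]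
    field_simp
    linear_combination -x 1 * norm_sq_plane v

theorem frameVec_e₁ (v : Plane) : frameVec v .e₁ = v := by
  refine Plane.ext ?_ ?_ <;> simp [frameVec, Plane.e₁]

theorem frameCoord_self {v : Plane} (hv : v ≠ 0) : frameCoord v v = .e₁ := by
  rw [← frameCoord_frameVec hv .e₁, frameVec_e₁]

theorem wedge_frameCoord_ne_zero_iff {v : Plane} (hv : v ≠ 0) (p q : Plane) :
    wedge (frameCoord v p) (frameCoord v q) ≠ 0 ↔ wedge p q ≠ 0 := by
  conv_rhs => rw [← frameVec_frameCoord hv p, ← frameVec_frameCoord hv q, wedge_frameVec]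
  simp [hv]

end Plane

section Lines

variable {N ι B : Type*} [Finite N] [Nontrivial N] [Finite ι] [TopologicalSpace B]

theorem LoopsContract.compl_lines_of_eq_e₁ (hB : LoopsContract N B) {ℓ : ι → B → Plane}
    (hℓ : ∀ i, Continuous (ℓ i)) {i₀ : ι} (h₀ : ∀ b, ℓ i₀ b = .e₁)
    (hd : ∀ b i j, i ≠ j → wedge (ℓ i b) (ℓ j b) ≠ 0) :
    LoopsContract N {p : B × Plane | ∀ i, wedge (ℓ i p.1) p.2 ≠ 0} := by
  have wedge_e₁ (p : Plane) : wedge .e₁ p = p 1 := by simp [wedge, Plane.e₁]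
  have hne (i : {i // i ≠ i₀}) (b : B) : ℓ i b 1 ≠ 0 := by
    have := hd b i₀ i i.2.symm
    rwa [h₀, wedge_e₁] at this
  have hline (b : B) (p : Plane) (i : {i // i ≠ i₀}) :
      wedge (ℓ i b) p ≠ 0 ↔ p 0 ≠ p 1 * (ℓ i b 0 / ℓ i b 1) := by
    rw [mul_div_assoc', Ne, Ne, eq_div_iff (hne i b), wedge, sub_eq_zero, eq_comm,
      mul_comm (p 1)]
  have hsecond : LoopsContract N {q : B × ℂ | ∀ _ : Unit, q.2 ≠ 0} :=
    hB.compl_sections (fun _ => continuous_const) fun _ => Function.injective_of_subsingleton _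
  have hboth := hsecond.compl_sections (ι := {i // i ≠ i₀})
    (ρ := fun i q => q.1.2 * (ℓ i q.1.1 0 / ℓ i q.1.1 1))
    (fun i => .mul (by fun_prop) (.div (by fun_prop) (by fun_prop) fun q => hne i q.1.1))
    (fun q i j hij => by
      by_contra hne'
      have hq := mul_left_cancel₀ (q.2 ()) hij
      rw [div_eq_div_iff (hne i _) (hne j _)] at hq
      exact hd q.1.1 i j (fun h => hne' (Subtype.ext h)) (sub_eq_zero.2 hq))
  refine hboth.of_retract
    ⟨fun p => ⟨(⟨(p.1.1, p.1.2 1), fun _ => ?_⟩, p.1.2 0), fun i => (hline _ _ i).1 (p.2 i)⟩,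
      by fun_prop⟩
    ⟨fun q => ⟨(q.1.1.1.1, !₂[q.1.2, q.1.1.1.2]), fun i => ?_⟩, ?_⟩ fun p => ?_
  · have := p.2 i₀
    rwa [h₀, wedge_e₁] at this
  · by_cases hi : i = i₀
    · subst hi
      simpa [h₀, wedge_e₁] using q.1.1.2 ()
    · exact (hline _ _ ⟨i, hi⟩).2 (q.2 ⟨i, hi⟩)
  · exact .subtype_mk (.prodMk (by fun_prop) (continuous_plane_mk (by fun_prop) (by fun_prop))) _
  · exact Subtype.ext (Prod.ext rfl (Plane.ext rfl rfl))

theorem LoopsContract.compl_lines (hB : LoopsContract N B) {ℓ : ι → B → Plane}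
    (hℓ : ∀ i, Continuous (ℓ i)) {i₀ : ι} (h₀ : ∀ b, ℓ i₀ b ≠ 0)
    (hd : ∀ b i j, i ≠ j → wedge (ℓ i b) (ℓ j b) ≠ 0) :
    LoopsContract N {p : B × Plane | ∀ i, wedge (ℓ i p.1) p.2 ≠ 0} := by
  have hstd := hB.compl_lines_of_eq_e₁ (ℓ := fun i b => frameCoord (ℓ i₀ b) (ℓ i b))
    (fun i => continuous_frameCoord (hℓ i₀) h₀ (hℓ i)) (fun b => frameCoord_self (h₀ b))
    (fun b i j hij => (wedge_frameCoord_ne_zero_iff (h₀ b) _ _).2 (hd b i j hij))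
  refine hstd.of_retract
    ⟨fun p => ⟨(p.1.1, frameCoord (ℓ i₀ p.1.1) p.1.2), fun i =>
      (wedge_frameCoord_ne_zero_iff (h₀ _) _ _).2 (p.2 i)⟩,
      .subtype_mk (.prodMk (by fun_prop)
        (continuous_frameCoord (by fun_prop) (fun _ => h₀ _) (by fun_prop))) _⟩
    ⟨fun q => ⟨(q.1.1, frameVec (ℓ i₀ q.1.1) q.1.2), fun i => ?_⟩, ?_⟩ fun p => ?_
  · rw [← wedge_frameCoord_ne_zero_iff (h₀ _), frameCoord_frameVec (h₀ _)]
    exact q.2 i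
  · exact .subtype_mk (.prodMk (by fun_prop) (continuous_frameVec (by fun_prop) (by fun_prop))) _
  · exact Subtype.ext (Prod.ext rfl (frameVec_frameCoord (h₀ _) _))

end Lines

section Ordering

variable {V : Type*} {G : SimpleGraph V} {τ : V → ℕ} {a : V}

/-- A perfect elimination numbering: the earlier neighbours of each vertex form a clique. -/
structure IsPerfectElimination (G : SimpleGraph V) (τ : V → ℕ) : Prop where
  injective : Function.Injective τ
  isClique (v : V) : G.IsClique (insert v {w | G.Adj v w ∧ τ w < τ v})

/-- A perfect elimination numbering in which `a` is the only non-isolated vertex without an earlier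
neighbour. -/
structure IsRootedElimination (G : SimpleGraph V) (τ : V → ℕ) (a : V) : Prop
    extends IsPerfectElimination G τ where
  root_lt {u : V} : G.Adj a u → τ a < τ u
  exists_earlier {w u : V} : G.Adj w u → w ≠ a → ∃ u', G.Adj w u' ∧ τ u' < τ w

theorem IsPerfectElimination.adj_of_earlier (hτ : IsPerfectElimination G τ) {v i j : V}
    (hi : G.Adj v i ∧ τ i < τ v) (hj : G.Adj v j ∧ τ j < τ v) (hij : i ≠ j) : G.Adj i j :=
  hτ.isClique v (Set.mem_insert_of_mem _ hi) (Set.mem_insert_of_mem _ hj) hij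

theorem IsPerfectElimination.lt_or_gt_of_adj (hτ : IsPerfectElimination G τ) {u w : V}
    (h : G.Adj u w) : τ u < τ w ∨ τ w < τ u :=
  lt_or_gt_of_ne (hτ.injective.ne h.ne)

theorem IsPerfectElimination.descends_of_adj (hτ : IsPerfectElimination G τ)
    (ha : ∀ u w, G.Adj u w → τ a ≤ τ u) {d u : V}
    (hd : Relation.ReflTransGen (fun x y => G.Adj x y ∧ τ y < τ x) d a) (hu : G.Adj u d) :
    Relation.ReflTransGen (fun x y => G.Adj x y ∧ τ y < τ x) u a := by
  induction hd using Relation.ReflTransGen.head_induction_on with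
  | refl => exact .single ⟨hu, (ha u a hu).lt_of_ne' (hτ.injective.ne hu.ne)⟩
  | @head d d' hdd' hd' ih =>
    rcases hτ.lt_or_gt_of_adj hu with hud | hdu
    · by_cases h : u = d'
      · exact h ▸ hd'
      · exact ih (hτ.adj_of_earlier ⟨hu.symm, hud⟩ hdd' h)
    · exact .head ⟨hu, hdu⟩ (.head hdd' hd')

theorem IsPerfectElimination.descends_of_reachable (hτ : IsPerfectElimination G τ)
    (ha : ∀ u w, G.Adj u w → τ a ≤ τ u) {v : V} (hv : G.Reachable v a) :
    Relation.ReflTransGen (fun x y => G.Adj x y ∧ τ y < τ x) v a := by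
  obtain ⟨p⟩ := hv
  induction p with
  | nil => exact .refl
  | cons h _ ih => exact hτ.descends_of_adj ha (ih ha) h

theorem IsPerfectElimination.exists_root (hτ : IsPerfectElimination G τ)
    (hc : ∃! c : G.ConnectedComponent, c.supp.Nontrivial) :
    ∃ a u, G.Adj a u ∧ IsRootedElimination G τ a := by
  obtain ⟨c, ⟨x, hx, y, hy, hxy⟩, huniq⟩ := hc
  have mem_component {u w} (h : G.Adj u w) : G.connectedComponentMk u = c :=
    huniq _ ⟨u, rfl, w, SimpleGraph.ConnectedComponent.sound h.symm.reachable, h.ne⟩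
  have hedge : {u | ∃ w, G.Adj u w}.Nonempty := by
    obtain ⟨p⟩ := SimpleGraph.ConnectedComponent.exact (hx.trans hy.symm)
    cases p with
    | nil => exact absurd rfl hxy
    | cons h _ => exact ⟨_, _, h⟩
  obtain ⟨a, ⟨u₀, hu₀⟩, hmin⟩ := WellFounded.has_min (measure τ).wf _ hedge
  have hmin' (u w : V) (h : G.Adj u w) : τ a ≤ τ u := not_lt.1 (hmin u ⟨w, h⟩)
  refine ⟨a, u₀, hu₀, hτ, fun {u} hu => ?_, fun {w u} hwu hwa => ?_⟩
  · exact (hmin' u a hu.symm).lt_of_ne (hτ.injective.ne hu.ne)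
  · have hwa' := SimpleGraph.ConnectedComponent.exact
      ((mem_component hwu).trans (mem_component hu₀).symm)
    rcases (hτ.descends_of_reachable hmin' hwa').cases_head with h | ⟨u', h, -⟩
    · exact absurd h hwa
    · exact ⟨u', h⟩

end Ordering

section Tower

variable {V : Type*} {G : SimpleGraph V} {τ : V → ℕ} {a : V}

theorem wedge_swap (v w : Plane) : wedge w v = -wedge v w := by
  unfold wedge
  ring

theorem wedge_ne_zero_comm {v w : Plane} : wedge v w ≠ 0 ↔ wedge w v ≠ 0 := by
  rw [wedge_swap, neg_ne_zero]

theorem ne_zero_of_wedge_ne_zero {v w : Plane} (h : wedge v w ≠ 0) : v ≠ 0 := by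
  rintro rfl
  simp [wedge] at h

/-- The assignments of vectors in `ℂ²` to the vertices that take the first basis vector at `a` and
linearly independent vectors at adjacent vertices numbered below `k`. -/
def tower (G : SimpleGraph V) (τ : V → ℕ) (a : V) (k : ℕ) : Set (V → Plane) :=
  {c | c a = .e₁ ∧ ∀ i j, G.Adj i j → τ i < k → τ j < k → wedge (c i) (c j) ≠ 0}

theorem contractibleSpace_tower_zero : ContractibleSpace (tower G τ a 0) := by
  have htower : tower G τ a 0 = {c | c a = .e₁} := by
    simp only [tower, not_lt_zero, false_imp_iff, implies_true, and_true]
  rw [htower]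
  refine Convex.contractibleSpace (fun c hc c' hc' s t _ _ hst => ?_) ⟨fun _ => .e₁, rfl⟩
  change s • c a + t • c' a = .e₁
  rw [hc, hc', ← add_smul, hst, one_smul]

theorem tower_anti {k l : ℕ} (hkl : k ≤ l) : tower G τ a l ⊆ tower G τ a k :=
  fun _ hc => ⟨hc.1, fun i j hij hi hj => hc.2 i j hij (hi.trans_le hkl) (hj.trans_le hkl)⟩

theorem tower_succ_eq_of_no_earlier (hτ : IsPerfectElimination G τ) {k : ℕ}
    (hk : ∀ v w, τ v = k → G.Adj v w → ¬ τ w < τ v) : tower G τ a (k + 1) = tower G τ a k := by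
  refine (tower_anti k.le_succ).antisymm fun c hc => ⟨hc.1, fun i j hij hi hj => ?_⟩
  have hi' := hk i j
  have hj' := hk j i
  rcases hτ.lt_or_gt_of_adj hij with h | h
  · exact hc.2 i j hij (by grind) (by grind [hij.symm])
  · exact hc.2 i j hij (by grind) (by grind)

theorem IsRootedElimination.ne_zero_of_mem_tower (hτ : IsRootedElimination G τ a) {k : ℕ}
    {c : V → Plane} (hc : c ∈ tower G τ a k) {v w : V} (hw : G.Adj w v) (hwk : τ w < k) :
    c w ≠ 0 := by
  by_cases hwa : w = a
  · rw [hwa, hc.1]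
    intro h
    simpa [Plane.e₁] using congrArg (· 0) h
  · obtain ⟨u, hu, huw⟩ := hτ.exists_earlier hw hwa
    exact ne_zero_of_wedge_ne_zero (hc.2 w u hu hwk (huw.trans hwk))

theorem IsRootedElimination.update_mem_tower_succ [DecidableEq V] (hτ : IsRootedElimination G τ a)
    {v : V} (hav : a ≠ v) {c : V → Plane} (hc : c ∈ tower G τ a (τ v)) {p : Plane}
    (hp : ∀ w, G.Adj v w → τ w < τ v → wedge (c w) p ≠ 0) :
    Function.update c v p ∈ tower G τ a (τ v + 1) := by
  have lt_of_ne {w : V} (hw : τ w < τ v + 1) (hwv : w ≠ v) : τ w < τ v :=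
    (Nat.lt_succ_iff.1 hw).lt_of_ne (hτ.injective.ne hwv)
  refine ⟨by rw [Function.update_of_ne hav, hc.1], fun i j hij hi hj => ?_⟩
  rcases eq_or_ne i v with rfl | hiv
  · rw [Function.update_self, Function.update_of_ne hij.ne', wedge_ne_zero_comm]
    exact hp j hij (lt_of_ne hj hij.ne')
  rcases eq_or_ne j v with rfl | hjv
  · rw [Function.update_self, Function.update_of_ne hij.ne]
    exact hp i hij.symm (lt_of_ne hi hij.ne)
  · rw [Function.update_of_ne hiv, Function.update_of_ne hjv]
    exact hc.2 i j hij (lt_of_ne hi hiv) (lt_of_ne hj hjv)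

variable {N : Type*} [Finite N] [Nontrivial N] [Finite V]

theorem IsRootedElimination.loopsContract_tower_succ_vertex (hτ : IsRootedElimination G τ a)
    {v w₀ : V} (hw₀ : G.Adj v w₀ ∧ τ w₀ < τ v) (hv : LoopsContract N (tower G τ a (τ v))) :
    LoopsContract N (tower G τ a (τ v + 1)) := by
  classical
  have hav : a ≠ v := by
    rintro rfl
    exact lt_asymm (hτ.root_lt hw₀.1) hw₀.2
  have hlines := hv.compl_lines (ι := {w // G.Adj v w ∧ τ w < τ v}) (ℓ := fun w c => c.1 w)
    (fun w => (continuous_apply w.1).comp continuous_subtype_val) (i₀ := ⟨w₀, hw₀⟩)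
    (fun c => hτ.ne_zero_of_mem_tower c.2 hw₀.1.symm hw₀.2)
    (fun c i j hij => c.2.2 i j (hτ.adj_of_earlier i.2 j.2 (Subtype.coe_ne_coe.2 hij)) i.2.2 j.2.2)
  refine hlines.of_retract
    ⟨fun c => ⟨(⟨c.1, tower_anti (Nat.le_succ _) c.2⟩, c.1 v), fun w =>
      c.2.2 w v w.2.1.symm (w.2.2.trans (Nat.lt_succ_self _)) (Nat.lt_succ_self _)⟩,
      .subtype_mk (.prodMk (by fun_prop) ((continuous_apply v).comp continuous_subtype_val)) _⟩
    ⟨fun q => ⟨Function.update q.1.1.1 v q.1.2,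
      hτ.update_mem_tower_succ hav q.1.1.2 fun w hw hwv => q.2 ⟨w, hw, hwv⟩⟩, ?_⟩ fun c => ?_
  · exact .subtype_mk (.update (by fun_prop) v (by fun_prop)) _
  · exact Subtype.ext (Function.update_eq_self v c.1)

theorem IsRootedElimination.loopsContract_tower (hτ : IsRootedElimination G τ a) (k : ℕ) :
    LoopsContract N (tower G τ a k) := by
  induction k with
  | zero =>
    have := contractibleSpace_tower_zero (G := G) (τ := τ) (a := a)
    exact .of_contractible
  | succ k ih =>
    by_cases hk : ∃ v w, τ v = k ∧ G.Adj v w ∧ τ w < τ v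
    · obtain ⟨v, w, rfl, hw⟩ := hk
      exact hτ.loopsContract_tower_succ_vertex hw ih
    · push Not at hk
      rw [tower_succ_eq_of_no_earlier hτ.toIsPerfectElimination
        fun v w hv hw => not_lt.2 (hk v w hv hw)]
      exact ih

end Tower

section Splitting

/-- The complement of the arrangement of `G`, with a matrix regarded as a family of columns. -/
def edgeComplement {V : Type*} (G : SimpleGraph V) : Set (V → Plane) :=
  {c | ∀ i j, G.Adj i j → wedge (c i) (c j) ≠ 0}

/-- The coordinate change that moves column `a` to the first basis vector. -/
noncomputable def normalizeColumn {V : Type*} {G : SimpleGraph V} {τ : V → ℕ} {a u : V}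
    (hau : G.Adj a u) {k : ℕ} (hk : ∀ v, τ v < k) :
    edgeComplement G ≃ₜ ({0}ᶜ : Set Plane) × tower G τ a k :=
  have ne_zero (c : edgeComplement G) : c.1 a ≠ 0 := ne_zero_of_wedge_ne_zero (c.2 a u hau)
  have continuous_eval (v : V) : Continuous fun c : edgeComplement G => c.1 v :=
    (continuous_apply v).comp continuous_subtype_val
  have continuous_eval_tower (v : V) : Continuous fun c : tower G τ a k => c.1 v :=
    (continuous_apply v).comp continuous_subtype_val
  { toFun := fun c => (⟨c.1 a, ne_zero c⟩, ⟨fun v => frameCoord (c.1 a) (c.1 v),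
      frameCoord_self (ne_zero c), fun i j hij _ _ =>
        (wedge_frameCoord_ne_zero_iff (ne_zero c) _ _).2 (c.2 i j hij)⟩)
    invFun := fun p => ⟨fun v => frameVec p.1 (p.2.1 v), fun i j hij => by
      rw [← wedge_frameCoord_ne_zero_iff p.1.2, frameCoord_frameVec p.1.2,
        frameCoord_frameVec p.1.2]
      exact p.2.2.2 i j hij (hk i) (hk j)⟩
    left_inv := fun c => Subtype.ext (funext fun _ => frameVec_frameCoord (ne_zero c) _)
    right_inv := by
      rintro ⟨⟨v, hv⟩, c, hc⟩
      have hva : frameVec v (c a) = v := by rw [hc.1, frameVec_e₁]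
      refine Prod.ext (Subtype.ext hva) (Subtype.ext (funext fun w => ?_))
      simp only [hva, frameCoord_frameVec hv]
    continuous_toFun := .prodMk (.subtype_mk (continuous_eval a) _) (.subtype_mk (continuous_pi
      fun v => continuous_frameCoord (continuous_eval a) ne_zero (continuous_eval v)) _)
    continuous_invFun := .subtype_mk (continuous_pi fun v => continuous_frameVec (by fun_prop)
      ((continuous_eval_tower v).comp continuous_snd)) _ }

theorem exists_sphere_homeomorph {E F : Type*} [NormedAddCommGroup E] [InnerProductSpace ℝ E]
    [FiniteDimensional ℝ E] [NormedAddCommGroup F] [InnerProductSpace ℝ F] [FiniteDimensional ℝ F]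
    (hEF : Module.finrank ℝ E = Module.finrank ℝ F) {r : ℝ} (x : Metric.sphere (0 : E) r)
    (y : Metric.sphere (0 : F) r) :
    ∃ h : Metric.sphere (0 : E) r ≃ₜ Metric.sphere (0 : F) r, h x = y := by
  let L : E ≃ₗᵢ[ℝ] F :=
    (stdOrthonormalBasis ℝ E).equiv (stdOrthonormalBasis ℝ F) (finCongr hEF)
  let R : F ≃ₗᵢ[ℝ] F := (ℝ ∙ (L x - y))ᗮ.reflection
  refine ⟨(L.trans R).toHomeomorph.subtype fun v => ?_, Subtype.ext ?_⟩
  · rw [mem_sphere_zero_iff_norm, mem_sphere_zero_iff_norm]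
    exact ((L.trans R).norm_map v).symm ▸ Iff.rfl
  · exact Submodule.reflection_sub (by
      rw [L.norm_map, norm_eq_of_mem_sphere, norm_eq_of_mem_sphere])

/-- The identification of a `2 × n` matrix with its family of columns. -/
def columns (n : ℕ) : Matrix (Fin 2) (Fin n) ℂ ≃ₜ (Fin n → Plane) where
  toFun M j := !₂[M 0 j, M 1 j]
  invFun c := .of fun i j => c j i
  left_inv M := by
    ext i j
    fin_cases i <;> rfl
  right_inv c := funext fun _ => Plane.ext rfl rfl
  continuous_toFun := continuous_pi fun j => continuous_plane_mk (by fun_prop) (by fun_prop)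
  continuous_invFun := continuous_matrix fun i j => by simp only [Matrix.of_apply]; fun_prop

theorem mem_complement_iff_columns_mem {n : ℕ} (G : SimpleGraph (Fin n))
    (M : Matrix (Fin 2) (Fin n) ℂ) : M ∈ complement G ↔ columns n M ∈ edgeComplement G := by
  constructor
  · intro hM i j hij hzero
    rcases hij.ne.lt_or_gt with hlt | hlt
    · exact hM ⟨detVariety i j, ⟨i, j, hlt, hij, rfl⟩, hzero⟩
    · refine hM ⟨detVariety j i, ⟨j, i, hlt, hij.symm, rfl⟩, ?_⟩
      change wedge (columns n M j) (columns n M i) = 0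
      rw [wedge_swap, hzero, neg_zero]
  · rintro hM ⟨_, ⟨i, j, -, hij, rfl⟩, hzero⟩
    exact hM i j hij hzero

theorem exists_sphere_splitting {n : ℕ} {G : SimpleGraph (Fin n)} {τ : Fin n → ℕ}
    {a u : Fin n} (hau : G.Adj a u) {k : ℕ} (hk : ∀ v, τ v < k) (M : complement G)
    (s : Metric.sphere (0 : EuclideanSpace ℝ (Fin 4)) 1) :
    ∃ e : complement G ≃ₜ
      Metric.sphere (0 : EuclideanSpace ℝ (Fin 4)) 1 × Set.Ioi (0 : ℝ) × tower G τ a k,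
      (e M).1 = s := by
  let e₀ : complement G ≃ₜ Metric.sphere (0 : Plane) 1 × Set.Ioi (0 : ℝ) × tower G τ a k :=
    (((columns n).subtype (mem_complement_iff_columns_mem G)).trans
      (normalizeColumn hau hk)).trans
      (((homeomorphUnitSphereProd Plane).prodCongr (.refl _)).trans (.prodAssoc _ _ _))
  have hrank : Module.finrank ℝ Plane = Module.finrank ℝ (EuclideanSpace ℝ (Fin 4)) := by
    rw [← Module.finrank_mul_finrank ℝ ℂ]
    simp
  obtain ⟨h, hh⟩ := exists_sphere_homeomorph hrank (e₀ M).1 s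
  exact ⟨e₀.trans (h.prodCongr (.refl _)), hh⟩

end Splitting

end DetArrangement

theorem theorem4p3 {n : ℕ} (G : SimpleGraph (Fin n))
    (hG : DetArrangement.IsChordal G)
    (hc : DetArrangement.HasUniqueNontrivialComponent G)
    (u : DetArrangement.complement G)
    (s : Metric.sphere (0 : EuclideanSpace ℝ (Fin 4)) 1)
    (i : ℕ) :
    Nonempty (π_ (i + 2) (DetArrangement.complement G) u ≃*
      π_ (i + 2) (Metric.sphere (0 : EuclideanSpace ℝ (Fin 4)) 1) s) := by
  obtain ⟨τ, hτ⟩ := hG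
  have helim : DetArrangement.IsPerfectElimination G fun v => (τ v : ℕ) :=
    ⟨Fin.val_injective.comp τ.injective, hτ⟩
  obtain ⟨a, w, haw, hroot⟩ := helim.exists_root hc
  obtain ⟨e, he⟩ := DetArrangement.exists_sphere_splitting haw (fun v => (τ v).isLt) u s
  have hray : ContractibleSpace (Set.Ioi (0 : ℝ)) :=
    (convex_Ioi 0).contractibleSpace Set.nonempty_Ioi
  have hfactor : DetArrangement.LoopsContract (Fin (i + 2))
      (Set.Ioi (0 : ℝ) × DetArrangement.tower G (fun v => (τ v : ℕ)) a n) :=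
    .prod .of_contractible (hroot.loopsContract_tower n)
  exact DetArrangement.nonempty_homotopyGroup_mulEquiv hfactor e he
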